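/- Let $\mathcal H$ be the Hilbert space of a single bosonic mode with orthonormal Fock basis $\{|n\rangle\}_{n\ge 0}$ and ladder operators $a|n\rangle=\sqrt n\,|n-1\rangle$, $a^\dagger|n\rangle=\sqrt{n+1}\,|n+1\rangle$. For $\xi\in\mathbb C$ let $D(\xi)=\exp(\xi a^\dagger-\xi^* a)$ be the displacement operator, and for a trace-class operator $\rho$ on $\mathcal H$ let $\chi_W[\rho](\xi)=\operatorname{Tr}(D(\xi)\rho)$ be its Weyl-ordered characteristic function. Let $\kappa>0$ and define, for $\ell=0,1,2,\dots$, $$T_\ell(\kappa)=\frac1{\sqrt{1+\kappa^2}}\sum_{n=0}^{\ell}\bigl(\sqrt{1+\kappa^2}\bigr)^{-n}\bigl(\sqrt{1+\kappa^{-2}}\bigr)^{-(\ell-n)}\sqrt{\binom{\ell}{n}}\;|\ell-n\rangle\langle n| .$$ Then the scaled phase-conjugation transformation with threshold noise, $$\chi_W(\xi)\;\mapsto\;\chi_W'(\xi)=\chi_W(-\kappa\,\xi^*)\,\exp\!\left[-\frac{(1+\kappa^2)|\xi|^2}{2}\right],$$ is a completely positive map, implemented linearly by the Kraus operators $T_\ell(\kappa)$.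 That is, there is a linear map $\Phi$ on the trace-class operators on $\mathcal H$ such that: (i) for every trace-class $\rho$, $\Phi(\rho)$ is the one and only trace-class operator $\rho'$ with $\chi_W[\rho'](\xi)=\chi_W[\rho](-\kappa\xi^*)\exp[-(1+\kappa^2)|\xi|^2/2]$ for all $\xi\in\mathbb C$; (ii) $\Phi$ is completely positive; (iii) $\Phi(\rho)=\sum_{\ell=0}^\infty T_\ell(\kappa)\,\rho\,T_\ell(\kappa)^\dagger$ for every trace-class $\rho$, with unconditional convergence in trace norm. -/

import Mathlib

open Filter Topology ComplexConjugate
open scoped ENNReal ComplexOrder InnerProductSpace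

noncomputable section

namespace PhaseConj

/-! ## Ladder operators and displacement operators of a single bosonic mode

Finite linear combinations of Fock states `|n⟩` are modelled by `ℕ →₀ ℂ`, with `|n⟩` being
`Finsupp.single n 1`. -/

/-- The creation operator `a†`, with `a† |n⟩ = √(n+1) |n+1⟩`, on finite combinations of Fock states. -/
def creation : Module.End ℂ (ℕ →₀ ℂ) :=
  Finsupp.linearCombination ℂ (fun n : ℕ => Finsupp.single (n + 1) ((√((n : ℝ) + 1) : ℝ) : ℂ))

/-- The annihilation operator `a`, with `a |n⟩ = √n |n-1⟩` (so `a |0⟩ = 0`), on finite combinations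
of Fock states. -/
def annihilation : Module.End ℂ (ℕ →₀ ℂ) :=
  Finsupp.linearCombination ℂ (fun n : ℕ => Finsupp.single (n - 1) ((√(n : ℝ) : ℝ) : ℂ))

/-- The operator `ξ a† - ξ* a` on finite combinations of Fock states. -/
def generator (ξ : ℂ) : Module.End ℂ (ℕ →₀ ℂ) := ξ • creation - conj ξ • annihilation

theorem generator_single (ξ : ℂ) (n : ℕ) : generator ξ (Finsupp.single n 1) =
    (ξ * ((√((n : ℝ) + 1) : ℝ) : ℂ)) • Finsupp.single (n + 1) 1
      - (conj ξ * ((√(n : ℝ) : ℝ) : ℂ)) • Finsupp.single (n - 1) 1 := by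
  simp [generator, creation, annihilation]

variable {H : Type*} [NormedAddCommGroup H] [InnerProductSpace ℂ H]

/-- The finite combination of Fock states as a vector of the Hilbert space with Fock basis `b`. -/
def toVec (b : HilbertBasis ℕ ℂ H) : (ℕ →₀ ℂ) →ₗ[ℂ] H := Finsupp.linearCombination ℂ b

theorem toVec_single (b : HilbertBasis ℕ ℂ H) (n : ℕ) : toVec b (Finsupp.single n 1) = b n := by
  simp [toVec]

/-- The `k`-th term `(ξ a† - ξ* a)^k |n⟩ / k!` of the exponential series applied to `|n⟩`. -/
def expTerm (b : HilbertBasis ℕ ℂ H) (ξ : ℂ) (n k : ℕ) : H :=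
  ((Nat.factorial k : ℂ)⁻¹) • toVec b ((generator ξ ^ k) (Finsupp.single n 1))

/-- `exp (ξ a† - ξ* a) |n⟩`, as the sum of its (norm convergent) exponential series. -/
def displacedFock (b : HilbertBasis ℕ ℂ H) (ξ : ℂ) (n : ℕ) : H := ∑' k, expTerm b ξ n k

theorem norm_generator_pow_le (b : HilbertBasis ℕ ℂ H) (ξ : ℂ) (k n : ℕ) :
    ‖toVec b ((generator ξ ^ k) (Finsupp.single n 1))‖
      ≤ (2 * ‖ξ‖) ^ k * ∏ j ∈ Finset.range k, √((n : ℝ) + 1 + j) := by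
  induction k generalizing n with
  | zero => simp [toVec_single, b.orthonormal.1 n]
  | succ k ih =>
    have mono : ∏ j ∈ Finset.range k, √(((n - 1 : ℕ) : ℝ) + 1 + j)
        ≤ ∏ j ∈ Finset.range k, √(((n + 1 : ℕ) : ℝ) + 1 + j) := by
      refine Finset.prod_le_prod (fun _ _ => Real.sqrt_nonneg _) (fun j _ => ?_)
      apply Real.sqrt_le_sqrt
      have : ((n - 1 : ℕ) : ℝ) ≤ ((n + 1 : ℕ) : ℝ) := by exact_mod_cast (by omega)
      linarith
    have hs : √(n : ℝ) ≤ √((n : ℝ) + 1) := Real.sqrt_le_sqrt (by linarith)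
    have key : ∏ j ∈ Finset.range (k + 1), √((n : ℝ) + 1 + j)
        = √((n : ℝ) + 1) * ∏ j ∈ Finset.range k, √(((n + 1 : ℕ) : ℝ) + 1 + j) := by
      rw [Finset.prod_range_succ', mul_comm]
      congr 1
      · simp
      · refine Finset.prod_congr rfl (fun j _ => ?_)
        congr 1
        push_cast
        ring
    rw [pow_succ, Module.End.mul_apply, generator_single, map_sub, map_smul, map_smul, map_sub,
      map_smul, map_smul, key]
    refine (norm_sub_le _ _).trans ?_
    rw [norm_smul, norm_smul, norm_mul, norm_mul, RCLike.norm_conj, Complex.norm_real,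
      Complex.norm_real, Real.norm_of_nonneg (Real.sqrt_nonneg _),
      Real.norm_of_nonneg (Real.sqrt_nonneg _)]
    set P := ∏ j ∈ Finset.range k, √(((n + 1 : ℕ) : ℝ) + 1 + j) with hP
    have h1 := ih (n + 1)
    have h2 : ‖toVec b ((generator ξ ^ k) (Finsupp.single (n - 1) 1))‖ ≤ (2 * ‖ξ‖) ^ k * P :=
      (ih (n - 1)).trans (by gcongr)
    calc ‖ξ‖ * √((n : ℝ) + 1) * ‖toVec b ((generator ξ ^ k) (Finsupp.single (n + 1) 1))‖
          + ‖ξ‖ * √(n : ℝ) * ‖toVec b ((generator ξ ^ k) (Finsupp.single (n - 1) 1))‖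
        ≤ ‖ξ‖ * √((n : ℝ) + 1) * ((2 * ‖ξ‖) ^ k * P)
          + ‖ξ‖ * √((n : ℝ) + 1) * ((2 * ‖ξ‖) ^ k * P) := by gcongr
      _ = (2 * ‖ξ‖) ^ (k + 1) * (√((n : ℝ) + 1) * P) := by ring

theorem summable_norm_expTerm (b : HilbertBasis ℕ ℂ H) (ξ : ℂ) (n : ℕ) :
    Summable (fun k => ‖expTerm b ξ n k‖) := by
  set g : ℕ → ℝ := fun k =>
    ((Nat.factorial k : ℝ)⁻¹) * ((2 * ‖ξ‖) ^ k * ∏ j ∈ Finset.range k, √((n : ℝ) + 1 + j)) with hg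
  have g0 : ∀ k, 0 ≤ g k := fun k => by simp only [hg]; positivity
  have gs : Summable g := by
    refine summable_of_ratio_norm_eventually_le (r := 1 / 2) (by norm_num) ?_
    have ht : Tendsto (fun k : ℕ => √((k : ℝ) + 1)) atTop atTop :=
      Real.tendsto_sqrt_atTop.comp
        (tendsto_atTop_add_const_right _ _ tendsto_natCast_atTop_atTop)
    filter_upwards [ht.eventually_ge_atTop (4 * ‖ξ‖ * √((n : ℝ) + 1))] with k hk
    rw [Real.norm_of_nonneg (g0 _), Real.norm_of_nonneg (g0 _)]
    have e : g (k + 1) = (((k : ℝ) + 1)⁻¹ * (2 * ‖ξ‖ * √((n : ℝ) + 1 + k))) * g k := by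
      simp only [hg, Finset.prod_range_succ, pow_succ, Nat.factorial_succ]
      push_cast
      rw [mul_inv]
      ring
    rw [e]
    refine mul_le_mul_of_nonneg_right ?_ (g0 k)
    have hk1 : (0 : ℝ) < (k : ℝ) + 1 := by positivity
    have h3 : √((n : ℝ) + 1 + k) ≤ √((n : ℝ) + 1) * √((k : ℝ) + 1) := by
      rw [← Real.sqrt_mul (by positivity)]
      apply Real.sqrt_le_sqrt
      nlinarith [mul_nonneg (Nat.cast_nonneg (α := ℝ) n) (Nat.cast_nonneg (α := ℝ) k)]
    have h4 : √((k : ℝ) + 1) * √((k : ℝ) + 1) = (k : ℝ) + 1 := Real.mul_self_sqrt hk1.le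
    have h5 : 4 * ‖ξ‖ * √((n : ℝ) + 1) * √((k : ℝ) + 1) ≤ (k : ℝ) + 1 := by
      exact (mul_le_mul_of_nonneg_right hk (Real.sqrt_nonneg _)).trans h4.le
    rw [inv_mul_le_iff₀ hk1]
    have h6 : ‖ξ‖ * √((n : ℝ) + 1 + k) ≤ ‖ξ‖ * (√((n : ℝ) + 1) * √((k : ℝ) + 1)) :=
      mul_le_mul_of_nonneg_left h3 (norm_nonneg _)
    nlinarith
  refine gs.of_nonneg_of_le (fun _ => norm_nonneg _) (fun k => ?_)
  rw [expTerm, norm_smul, norm_inv, Complex.norm_natCast]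
  exact mul_le_mul_of_nonneg_left (norm_generator_pow_le b ξ k n) (by positivity)

theorem inner_generator (b : HilbertBasis ℕ ℂ H) (ξ : ℂ) (f g : ℕ →₀ ℂ) :
    ⟪toVec b (generator ξ f), toVec b g⟫_ℂ = -⟪toVec b f, toVec b (generator ξ g)⟫_ℂ := by
  induction f using Finsupp.induction_linear with
  | zero => simp
  | add f₁ f₂ h₁ h₂ => rw [map_add, map_add, map_add, inner_add_left, inner_add_left, h₁, h₂]; ring
  | single m c =>
    induction g using Finsupp.induction_linear with
    | zero => simp
    | add g₁ g₂ h₁ h₂ =>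
      rw [map_add, map_add, map_add, inner_add_right, inner_add_right, h₁, h₂]; ring
    | single n d =>
      rw [← mul_one c, ← mul_one d, ← smul_eq_mul, ← smul_eq_mul, ← Finsupp.smul_single,
        ← Finsupp.smul_single]
      simp only [map_smul, inner_smul_left, inner_smul_right, generator_single, map_sub,
        toVec_single, inner_sub_left, inner_sub_right, map_mul, Complex.conj_conj,
        Complex.conj_ofReal, orthonormal_iff_ite.1 b.orthonormal]
      rcases m with _ | m <;> rcases n with _ | n <;> simp <;> split_ifs <;>
        first
        | omega
        | (subst_vars; push_cast; ring_nf; done)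
        | (subst_vars; simp [mul_comm, mul_left_comm])

theorem inner_generator_pow (b : HilbertBasis ℕ ℂ H) (ξ : ℂ) (j : ℕ) (f g : ℕ →₀ ℂ) :
    ⟪toVec b ((generator ξ ^ j) f), toVec b g⟫_ℂ
      = (-1) ^ j * ⟪toVec b f, toVec b ((generator ξ ^ j) g)⟫_ℂ := by
  induction j generalizing f with
  | zero => simp
  | succ j ih =>
    rw [pow_succ, Module.End.mul_apply, ih, inner_generator, ← Module.End.mul_apply, ← pow_succ',
      pow_succ (-1 : ℂ), pow_succ (generator ξ)]
    ring

theorem inner_displacedFock [CompleteSpace H] (b : HilbertBasis ℕ ℂ H) (ξ : ℂ) (m n : ℕ) :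
    ⟪displacedFock b ξ m, displacedFock b ξ n⟫_ℂ = if m = n then 1 else 0 := by
  have sm := summable_norm_expTerm b ξ m
  have sn := summable_norm_expTerm b ξ n
  have hsum : Summable (fun p : ℕ × ℕ => ⟪expTerm b ξ m p.1, expTerm b ξ n p.2⟫_ℂ) := by
    refine Summable.of_norm_bounded (sm.mul_of_nonneg sn (fun _ => norm_nonneg _)
      (fun _ => norm_nonneg _)) (fun p => norm_inner_le_norm _ _)
  have h1 : ⟪displacedFock b ξ m, displacedFock b ξ n⟫_ℂ
      = ∑' p : ℕ × ℕ, ⟪expTerm b ξ m p.1, expTerm b ξ n p.2⟫_ℂ := by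
    rw [hsum.tsum_prod]
    have hm : HasSum (expTerm b ξ m) (displacedFock b ξ m) := sm.of_norm.hasSum
    have hn : HasSum (expTerm b ξ n) (displacedFock b ξ n) := sn.of_norm.hasSum
    have e1 : ∀ j, ∑' k, ⟪expTerm b ξ m j, expTerm b ξ n k⟫_ℂ
        = ⟪expTerm b ξ m j, displacedFock b ξ n⟫_ℂ := fun j =>
      (hn.mapL (innerSL ℂ (expTerm b ξ m j))).tsum_eq
    simp only [e1]
    have := hm.mapL ((innerSLFlip ℂ) (displacedFock b ξ n))
    exact this.tsum_eq.symm
  have hsig : Summable (fun c : (N : ℕ) × Finset.HasAntidiagonal.antidiagonal N =>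
      ⟪expTerm b ξ m c.2.1.1, expTerm b ξ n c.2.1.2⟫_ℂ) :=
    Finset.HasAntidiagonal.sigmaAntidiagonalEquivProd.summable_iff.2 hsum
  rw [h1, ← Finset.HasAntidiagonal.sigmaAntidiagonalEquivProd.tsum_eq]
  change ∑' c : (N : ℕ) × Finset.HasAntidiagonal.antidiagonal N,
    ⟪expTerm b ξ m c.2.1.1, expTerm b ξ n c.2.1.2⟫_ℂ = _
  rw [Summable.tsum_sigma' (fun _ => (hasSum_fintype _).summable)
      hsig]
  have h2 : ∀ N : ℕ, (∑' p : Finset.HasAntidiagonal.antidiagonal N, ⟪expTerm b ξ m p.1.1, expTerm b ξ n p.1.2⟫_ℂ)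
      = if N = 0 then (if m = n then 1 else 0) else 0 := by
    intro N
    rw [tsum_fintype, Finset.univ_eq_attach, Finset.sum_attach (Finset.HasAntidiagonal.antidiagonal N)
      (fun p => ⟪expTerm b ξ m p.1, expTerm b ξ n p.2⟫_ℂ)]
    have h3 : ∀ p ∈ Finset.HasAntidiagonal.antidiagonal N, ⟪expTerm b ξ m p.1, expTerm b ξ n p.2⟫_ℂ
        = ((-1) ^ p.1 * 1 ^ p.2 * (N.choose p.1 : ℂ)) * (((Nat.factorial N : ℂ)⁻¹)
          * ⟪b m, toVec b ((generator ξ ^ N) (Finsupp.single n 1))⟫_ℂ) := by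
      rintro ⟨i, j⟩ hp
      obtain rfl : i + j = N := by simpa using hp
      simp only [expTerm, inner_smul_left, inner_smul_right, inner_generator_pow, toVec_single]
      rw [← Module.End.mul_apply, ← pow_add, map_inv₀, Complex.conj_natCast]
      have hc : ((i + j).choose i : ℂ) * (i.factorial : ℂ) * (j.factorial : ℂ)
          = ((i + j).factorial : ℂ) := by
        have := Nat.choose_mul_factorial_mul_factorial (Nat.le_add_right i j)
        rw [Nat.add_sub_cancel_left] at this
        exact_mod_cast this
      have hi : (i.factorial : ℂ) ≠ 0 := by exact_mod_cast i.factorial_ne_zero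
      have hj : (j.factorial : ℂ) ≠ 0 := by exact_mod_cast j.factorial_ne_zero
      have hij : ((i + j).factorial : ℂ) ≠ 0 := by exact_mod_cast (i + j).factorial_ne_zero
      field_simp
      rw [← hc]
      ring
    rw [Finset.sum_congr rfl h3, ← Finset.sum_mul]
    have h4 : ∑ p ∈ Finset.HasAntidiagonal.antidiagonal N, ((-1 : ℂ) ^ p.1 * 1 ^ p.2 * (N.choose p.1 : ℂ))
        = if N = 0 then 1 else 0 := by
      have := (Commute.all (-1 : ℂ) 1).add_pow' N
      rw [neg_add_cancel, zero_pow_eq] at this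
      rw [this]
      exact Finset.sum_congr rfl (fun p _ => by simp [mul_comm])
    rw [h4]
    by_cases hN : N = 0
    · subst hN
      have hb := orthonormal_iff_ite.1 b.orthonormal m n
      simp [toVec_single, hb]
    · rw [if_neg hN, if_neg hN, zero_mul]
  refine (tsum_congr h2).trans ?_
  rw [tsum_ite_eq]

theorem orthonormal_displacedFock [CompleteSpace H] (b : HilbertBasis ℕ ℂ H) (ξ : ℂ) :
    Orthonormal ℂ (displacedFock b ξ) :=
  orthonormal_iff_ite.2 (inner_displacedFock b ξ)

/-- The displacement operator `D(ξ) = exp (ξ a† - ξ* a)`: the bounded operator which maps each Fock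
state `|n⟩` to the sum of the exponential series applied to it. -/
def displacement [CompleteSpace H] (b : HilbertBasis ℕ ℂ H) (ξ : ℂ) : H →L[ℂ] H :=
  ((orthonormal_displacedFock b ξ).orthogonalFamily.linearIsometry.comp
    b.repr.toLinearIsometry).toContinuousLinearMap

theorem displacement_apply_fock [CompleteSpace H] (b : HilbertBasis ℕ ℂ H) (ξ : ℂ) (n : ℕ) :
    displacement b ξ (b n) = displacedFock b ξ n := by
  classical
  simp only [displacement, LinearIsometry.coe_toContinuousLinearMap, LinearIsometry.coe_comp,
    Function.comp_apply, LinearIsometryEquiv.coe_toLinearIsometry, b.repr_self]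
  rw [OrthogonalFamily.linearIsometry_apply_single]
  simp

theorem hasSum_displacement [CompleteSpace H] (b : HilbertBasis ℕ ℂ H) (ξ : ℂ) (n : ℕ) :
    HasSum (expTerm b ξ n) (displacement b ξ (b n)) := by
  rw [displacement_apply_fock]
  exact (summable_norm_expTerm b ξ n).of_norm.hasSum

/-! ## Trace-class operators -/

/-- `T = ∑ i, |x i⟩⟨y i|`. -/
def IsDyadSum (x y : ℕ → H) (T : H →L[ℂ] H) : Prop :=
  ∀ v : H, HasSum (fun i => ⟪y i, v⟫_ℂ • x i) (T v)

/-- The trace norm `‖T‖₁ = Tr |T|` of a bounded operator, in its nuclear form: the infimum of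
`∑ ‖x i‖ ‖y i‖` over all expansions `T = ∑ i, |x i⟩⟨y i|`. It is `∞` if `T` is not trace class. -/
def traceNorm (T : H →L[ℂ] H) : ℝ≥0∞ :=
  ⨅ (x : ℕ → H) (y : ℕ → H) (_ : IsDyadSum x y T), ∑' i, ‖x i‖ₑ * ‖y i‖ₑ

/-- An operator on a Hilbert space is trace class if it is nuclear:
`T = ∑ i, |x i⟩⟨y i|` with `∑ ‖x i‖ ‖y i‖ < ∞`. -/
def IsTraceClass (T : H →L[ℂ] H) : Prop :=
  ∃ x y : ℕ → H, Summable (fun i => ‖x i‖ * ‖y i‖) ∧ IsDyadSum x y T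

theorem IsTraceClass.add {S T : H →L[ℂ] H} (hS : IsTraceClass S) (hT : IsTraceClass T) :
    IsTraceClass (S + T) := by
  obtain ⟨x, y, h, hxy⟩ := hS
  obtain ⟨x', y', h', hxy'⟩ := hT
  obtain ⟨e⟩ : Nonempty (ℕ ≃ ℕ ⊕ ℕ) := ⟨Equiv.natSumNatEquivNat.symm⟩
  refine ⟨Sum.elim x x' ∘ e, Sum.elim y y' ∘ e, ?_, fun v => ?_⟩
  · have : Summable (fun s : ℕ ⊕ ℕ => ‖Sum.elim x x' s‖ * ‖Sum.elim y y' s‖) :=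
      (HasSum.sum (f := fun s : ℕ ⊕ ℕ => ‖Sum.elim x x' s‖ * ‖Sum.elim y y' s‖)
        h.hasSum h'.hasSum).summable
    exact e.summable_iff.2 this
  · have : HasSum (fun s : ℕ ⊕ ℕ => ⟪Sum.elim y y' s, v⟫_ℂ • Sum.elim x x' s) (S v + T v) :=
      HasSum.sum (hxy v) (hxy' v)
    exact e.hasSum_iff.2 this

/-- The space of trace-class operators on `H`. -/
def TraceClass (H : Type*) [NormedAddCommGroup H] [InnerProductSpace ℂ H] :
    Submodule ℂ (H →L[ℂ] H) where
  carrier := {T | IsTraceClass T}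
  add_mem' := IsTraceClass.add
  zero_mem' := ⟨0, 0, by simp, fun v => by simp⟩
  smul_mem' := by
    rintro c T ⟨x, y, h, hxy⟩
    refine ⟨fun i => c • x i, y, ?_, fun v => ?_⟩
    · simpa only [norm_smul, mul_assoc] using h.mul_left ‖c‖
    · simpa only [smul_comm c, smul_apply] using (hxy v).const_smul c

/-- The trace `Tr T = ∑ n, ⟨n|T|n⟩`, used only for trace-class `T` (the series is then absolutely
convergent and its sum does not depend on the orthonormal basis). -/
def trace (b : HilbertBasis ℕ ℂ H) (T : H →L[ℂ] H) : ℂ := ∑' n, ⟪b n, T (b n)⟫_ℂ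

/-! ## Characteristic functions, phase conjugation, Kraus operators -/

/-- The Weyl-ordered characteristic function `χ_W(ξ) = Tr (D(ξ) ρ)` of a trace-class operator. -/
def weylChar [CompleteSpace H] (b : HilbertBasis ℕ ℂ H) (ρ : TraceClass H) (ξ : ℂ) : ℂ :=
  trace b (displacement b ξ ∘L (ρ : H →L[ℂ] H))

/-- The scaled phase conjugation transformation of characteristic functions, with threshold noise:
`χ ↦ (ξ ↦ χ(-κ ξ*) exp(-(1+κ²)|ξ|²/2))`. -/
def phaseConj (κ : ℝ) (χ : ℂ → ℂ) (ξ : ℂ) : ℂ :=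
  χ (-(κ : ℂ) * conj ξ) * Complex.exp (((-(1 + κ ^ 2) * ‖ξ‖ ^ 2 / 2 : ℝ) : ℂ))

/-- The Kraus operators
`T_ℓ(κ) = (√(1+κ²))⁻¹ ∑_{n=0}^{ℓ} (√(1+κ²))⁻ⁿ (√(1+κ⁻²))^{-(ℓ-n)} √(ℓ choose n) |ℓ-n⟩⟨n|`. -/
def kraus (b : HilbertBasis ℕ ℂ H) (κ : ℝ) (l : ℕ) : H →L[ℂ] H :=
  (((√(1 + κ ^ 2))⁻¹ : ℝ) : ℂ) • ∑ n ∈ Finset.range (l + 1),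
    (((√(1 + κ ^ 2))⁻¹ ^ n * (√(1 + (κ ^ 2)⁻¹))⁻¹ ^ (l - n) * √(l.choose n : ℝ) : ℝ) : ℂ) •
      InnerProductSpace.rankOne ℂ (b (l - n)) (b n)

/-- The block operator `(R i j)` on `H ⊕ ⋯ ⊕ H` (`k` summands) is positive. -/
def BlockPositive {k : ℕ} (R : Fin k → Fin k → TraceClass H) : Prop :=
  ∀ x : Fin k → H, 0 ≤ ∑ i, ∑ j, ⟪x i, (R i j : H →L[ℂ] H) (x j)⟫_ℂ

/-- A linear map on trace-class operators is completely positive if, for every `k`, its entrywise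
application to `k × k` matrices of trace-class operators preserves positivity. -/
def IsCompletelyPositive (Φ : TraceClass H →ₗ[ℂ] TraceClass H) : Prop :=
  ∀ (k : ℕ) (R : Fin k → Fin k → TraceClass H), BlockPositive R →
    BlockPositive (fun i j => Φ (R i j))

end PhaseConj

end

/-!
The map `Φ ρ = ∑ l, T_l ρ T_l†` is completely positive by construction. Expanding a trace-class
operator in dyads `|x⟩⟨y|`, everything else about `Φ` reduces to statements about `T_l x`. The
identity `∑ l, ‖T_l v‖² = ‖v‖²` (`hasSum_norm_sq_kraus`) and the Cauchy-Schwarz inequality give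
the convergence of the Kraus series in trace norm (`tendsto_traceNorm_krausSum_sub`).

The action on characteristic functions is the Heisenberg picture identity
`∑ l, T_l† D(ξ) T_l = exp (-(1+κ²)|ξ|²/2) D(-κ ξ*)` (`hasSum_inner_kraus`). The matrix elements
of a displacement operator satisfy the ladder relations `a D(ξ) = D(ξ) (a + ξ)` and
`a† D(ξ) = D(ξ) (a† + ξ*)`, which determine an array of matrix elements from its vacuum entry
(`eq_zero_of_ladder_relations`). The Kraus operators satisfy `a T_l = κ T_l a†`,
`T_{l+1} a† = s √(l+1) T_l` and `√(l+1) T_{l+1} = s T_l a + t a† T_l`, where `s = 1 / √(1+κ²)`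
and `t = κ s`. Hence the left hand side obeys the ladder relations of `D(-κ ξ*)`, and the vacuum
entries agree by the generating function of the Laguerre polynomials (`hasSum_laguerre`).

Uniqueness is the injectivity of `ρ ↦ χ_W[ρ]` (`eq_zero_of_weylChar_eq_zero`). On coherent
vectors the displacement operators are explicit Gaussians (`displacement_coherent`), and a
Gaussian integral gives `π |e_β⟩⟨e_α| = ∫ ⟨e_α, D(-ξ) e_β⟩ D(ξ) dξ` weakly. So `χ_W[σ] = 0`
forces `⟨e_α, σ e_β⟩ = 0` for all coherent vectors, which are total.
-/

open Filter Topology ComplexConjugate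
open scoped ENNReal ComplexOrder InnerProductSpace

noncomputable section

namespace PhaseConj

variable {H : Type*} [NormedAddCommGroup H] [InnerProductSpace ℂ H]

/-! ### Fock matrix elements of the displacement operators -/

theorem toVec_coeff (b : HilbertBasis ℕ ℂ H) (m : ℕ) (f : ℕ →₀ ℂ) : ⟪b m, toVec b f⟫_ℂ = f m := by
  rw [toVec]
  exact b.orthonormal.inner_right_finsupp f m

theorem annihilation_apply (f : ℕ →₀ ℂ) (m : ℕ) :
    annihilation f m = ((√((m : ℝ) + 1) : ℝ) : ℂ) * f (m + 1) := by
  induction f using Finsupp.induction_linear with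
  | zero => simp
  | add f g hf hg => simp [map_add, hf, hg, mul_add]
  | single n c =>
    rcases n with _ | n
    · simp [annihilation]
    · by_cases h : n = m
      · subst h
        simp [annihilation, mul_comm]
      · simp [annihilation, h]

theorem creation_apply (f : ℕ →₀ ℂ) (m : ℕ) :
    creation f m = ((√(m : ℝ) : ℝ) : ℂ) * f (m - 1) := by
  induction f using Finsupp.induction_linear with
  | zero => simp
  | add f g hf hg => simp [map_add, hf, hg, mul_add]
  | single n c =>
    rcases m with _ | m
    · simp [creation]
    · by_cases h : n = m
      · subst h
        simp [creation, mul_comm]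
      · simp [creation, h]

/-- The canonical commutation relation `[a, a†] = 1`. -/
theorem annihilation_mul_creation : annihilation * creation = creation * annihilation + 1 := by
  ext n m
  have h1 : ((√((n : ℝ) + 1) : ℝ) : ℂ) * ((√((n : ℝ) + 1) : ℝ) : ℂ) = n + 1 := by
    rw [← Complex.ofReal_mul, Real.mul_self_sqrt (by positivity)]
    push_cast
    ring
  have h2 : ((√(n : ℝ) : ℝ) : ℂ) * ((√(n : ℝ) : ℝ) : ℂ) = n := by
    rw [← Complex.ofReal_mul, Real.mul_self_sqrt (by positivity)]
    push_cast
    ring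
  by_cases h : n = m
  · subst h
    rcases n with _ | n
    · simp [annihilation, creation]
    · have h2' := h2
      push_cast at h1 h2'
      simp [annihilation, creation, h1, h2']
  · rcases n with _ | n <;> simp [annihilation, creation, h]

theorem annihilation_mul_generator (ξ : ℂ) :
    annihilation * generator ξ = generator ξ * annihilation + ξ • 1 := by
  refine LinearMap.ext fun f => ?_
  have h := LinearMap.congr_fun annihilation_mul_creation f
  simp only [Module.End.mul_apply, LinearMap.add_apply, Module.End.one_apply] at h
  simp only [generator, Module.End.mul_apply, LinearMap.add_apply, LinearMap.sub_apply,
    LinearMap.smul_apply, Module.End.one_apply, map_sub, map_smul, h, smul_add]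
  abel

theorem creation_mul_generator (ξ : ℂ) :
    creation * generator ξ = generator ξ * creation + conj ξ • 1 := by
  refine LinearMap.ext fun f => ?_
  have h := LinearMap.congr_fun annihilation_mul_creation f
  simp only [Module.End.mul_apply, LinearMap.add_apply, Module.End.one_apply] at h
  simp only [generator, Module.End.mul_apply, LinearMap.add_apply, LinearMap.sub_apply,
    LinearMap.smul_apply, Module.End.one_apply, map_sub, map_smul, h, smul_add]
  abel

theorem mul_pow_succ_of_commutator {A : Type*} [Ring A] [Algebra ℂ A] {x g : A} {c : ℂ}
    (h : x * g = g * x + c • 1) (k : ℕ) :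
    x * g ^ (k + 1) = g ^ (k + 1) * x + (((k : ℂ) + 1) * c) • g ^ k := by
  induction k with
  | zero => simp [h]
  | succ k ih =>
    rw [pow_succ g (k + 1), ← mul_assoc, ih, add_mul, mul_assoc, h, mul_add, smul_mul_assoc,
      ← pow_succ, mul_smul_comm, mul_one, add_assoc, ← add_smul, ← mul_assoc]
    congr 2
    push_cast
    ring

/-- The coefficients of the exponential series of `D(ξ)|n⟩`. -/
def expCoeff (ξ : ℂ) (m n k : ℕ) : ℂ :=
  ((Nat.factorial k : ℂ)⁻¹) * ((generator ξ ^ k) (Finsupp.single n 1)) m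

theorem inv_factorial_succ_mul (k : ℕ) :
    (((k + 1).factorial : ℂ)⁻¹) * ((k : ℂ) + 1) = (k.factorial : ℂ)⁻¹ := by
  have h : ((k : ℂ) + 1) ≠ 0 := by exact_mod_cast k.succ_ne_zero
  have h' : (k.factorial : ℂ) ≠ 0 := by exact_mod_cast k.factorial_ne_zero
  rw [Nat.factorial_succ]
  push_cast
  field_simp

theorem expCoeff_annihilation (ξ : ℂ) (m n k : ℕ) :
    ((√((m : ℝ) + 1) : ℝ) : ℂ) * expCoeff ξ (m + 1) n (k + 1)
      = ((√(n : ℝ) : ℝ) : ℂ) * expCoeff ξ m (n - 1) (k + 1) + ξ * expCoeff ξ m n k := by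
  have h := congrArg (fun T : Module.End ℂ (ℕ →₀ ℂ) => T (Finsupp.single n 1) m)
    (mul_pow_succ_of_commutator (annihilation_mul_generator ξ) k)
  have ha : annihilation (Finsupp.single n 1)
      = ((√(n : ℝ) : ℝ) : ℂ) • Finsupp.single (n - 1) (1 : ℂ) := by simp [annihilation]
  simp only [LinearMap.add_apply, Module.End.mul_apply, LinearMap.smul_apply, annihilation_apply,
    ha, map_smul, Finsupp.add_apply, Finsupp.smul_apply, smul_eq_mul] at h
  simp only [expCoeff]
  rw [mul_left_comm, h, ← inv_factorial_succ_mul k]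
  ring

theorem expCoeff_creation (ξ : ℂ) (m n k : ℕ) :
    ((√(m : ℝ) : ℝ) : ℂ) * expCoeff ξ (m - 1) n (k + 1)
      = ((√((n : ℝ) + 1) : ℝ) : ℂ) * expCoeff ξ m (n + 1) (k + 1) + conj ξ * expCoeff ξ m n k := by
  have h := congrArg (fun T : Module.End ℂ (ℕ →₀ ℂ) => T (Finsupp.single n 1) m)
    (mul_pow_succ_of_commutator (creation_mul_generator ξ) k)
  have ha : creation (Finsupp.single n 1)
      = ((√((n : ℝ) + 1) : ℝ) : ℂ) • Finsupp.single (n + 1) (1 : ℂ) := by simp [creation]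
  simp only [LinearMap.add_apply, Module.End.mul_apply, LinearMap.smul_apply, creation_apply,
    ha, map_smul, Finsupp.add_apply, Finsupp.smul_apply, smul_eq_mul] at h
  simp only [expCoeff]
  rw [mul_left_comm, h, ← inv_factorial_succ_mul k]
  ring

theorem expCoeff_zero_zero_add_two (ξ : ℂ) (k : ℕ) :
    expCoeff ξ 0 0 (k + 2) = -(ξ * conj ξ) / ((k : ℂ) + 2) * expCoeff ξ 0 0 k := by
  have h1 : expCoeff ξ 0 1 (k + 1) = -conj ξ * expCoeff ξ 0 0 k := by
    have := expCoeff_creation ξ 0 0 k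
    simp only [Nat.cast_zero, Real.sqrt_zero, Complex.ofReal_zero, zero_mul, zero_add,
      Real.sqrt_one, Complex.ofReal_one, one_mul] at this
    linear_combination -this
  have h2 : ((k : ℂ) + 2) * expCoeff ξ 0 0 (k + 2) = ξ * expCoeff ξ 0 1 (k + 1) := by
    have hf := inv_factorial_succ_mul (k + 1)
    push_cast at hf
    have hg := generator_single ξ 0
    simp only [Nat.cast_zero, zero_add, Real.sqrt_one, Complex.ofReal_one, mul_one,
      Real.sqrt_zero, Complex.ofReal_zero, mul_zero, zero_smul, sub_zero] at hg
    simp only [expCoeff]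
    rw [pow_succ (generator ξ) (k + 1), Module.End.mul_apply, hg, map_smul, Finsupp.smul_apply,
      smul_eq_mul, ← hf]
    ring
  have h3 : ((k : ℂ) + 2) ≠ 0 := by exact_mod_cast (by omega : k + 2 ≠ 0)
  rw [h1] at h2
  field_simp
  linear_combination h2

theorem expCoeff_zero_zero_even (ξ : ℂ) (j : ℕ) :
    expCoeff ξ 0 0 (2 * j) = ((j.factorial : ℂ)⁻¹) * (-(ξ * conj ξ) / 2) ^ j := by
  induction j with
  | zero => simp [expCoeff]
  | succ j ih =>
    rw [mul_add, mul_one, expCoeff_zero_zero_add_two, ih, ← inv_factorial_succ_mul j, pow_succ]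
    have h : ((j : ℂ) + 1) ≠ 0 := by exact_mod_cast j.succ_ne_zero
    have h2 : ((2 * j : ℕ) : ℂ) + 2 = 2 * ((j : ℂ) + 1) := by push_cast; ring
    rw [h2]
    field_simp

theorem expCoeff_zero_zero_odd (ξ : ℂ) (j : ℕ) : expCoeff ξ 0 0 (2 * j + 1) = 0 := by
  induction j with
  | zero =>
    have hg := generator_single ξ 0
    simp [expCoeff, hg]
  | succ j ih =>
    rw [show 2 * (j + 1) + 1 = (2 * j + 1) + 2 by ring, expCoeff_zero_zero_add_two, ih, mul_zero]

section

variable [CompleteSpace H]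

/-- The matrix element `⟨m|D(ξ)|n⟩`. -/
def dispElem (b : HilbertBasis ℕ ℂ H) (ξ : ℂ) (m n : ℕ) : ℂ := ⟪b m, displacement b ξ (b n)⟫_ℂ

theorem hasSum_expCoeff (b : HilbertBasis ℕ ℂ H) (ξ : ℂ) (m n : ℕ) :
    HasSum (expCoeff ξ m n) (dispElem b ξ m n) := by
  have h := (hasSum_displacement b ξ n).mapL (innerSL ℂ (b m))
  simp only [innerSL_apply_apply, expTerm, inner_smul_right, toVec_coeff] at h
  exact h

/-- `a D(ξ) = D(ξ) (a + ξ)`, in matrix elements. -/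
theorem dispElem_annihilation (b : HilbertBasis ℕ ℂ H) (ξ : ℂ) (m n : ℕ) :
    ((√((m : ℝ) + 1) : ℝ) : ℂ) * dispElem b ξ (m + 1) n
      = ((√(n : ℝ) : ℝ) : ℂ) * dispElem b ξ m (n - 1) + ξ * dispElem b ξ m n := by
  have h1 := ((hasSum_nat_add_iff' 1).2 (hasSum_expCoeff b ξ (m + 1) n)).mul_left
    ((√((m : ℝ) + 1) : ℝ) : ℂ)
  have h2 := (((hasSum_nat_add_iff' 1).2 (hasSum_expCoeff b ξ m (n - 1))).mul_left
    ((√(n : ℝ) : ℝ) : ℂ)).add ((hasSum_expCoeff b ξ m n).mul_left ξ)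
  simp only [expCoeff_annihilation] at h1
  have h := h1.unique h2
  have h0 : ((√((m : ℝ) + 1) : ℝ) : ℂ) * expCoeff ξ (m + 1) n 0
      = ((√(n : ℝ) : ℝ) : ℂ) * expCoeff ξ m (n - 1) 0 := by
    have := annihilation_apply (Finsupp.single n 1) m
    simp [annihilation, Finsupp.single_apply] at this
    simp [expCoeff, Finsupp.single_apply, this]
  simp only [Finset.sum_range_one] at h
  linear_combination h + h0

/-- `a† D(ξ) = D(ξ) (a† + ξ*)`, in matrix elements. -/
theorem dispElem_creation (b : HilbertBasis ℕ ℂ H) (ξ : ℂ) (m n : ℕ) :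
    ((√(m : ℝ) : ℝ) : ℂ) * dispElem b ξ (m - 1) n
      = ((√((n : ℝ) + 1) : ℝ) : ℂ) * dispElem b ξ m (n + 1) + conj ξ * dispElem b ξ m n := by
  have h1 := ((hasSum_nat_add_iff' 1).2 (hasSum_expCoeff b ξ (m - 1) n)).mul_left
    ((√(m : ℝ) : ℝ) : ℂ)
  have h2 := (((hasSum_nat_add_iff' 1).2 (hasSum_expCoeff b ξ m (n + 1))).mul_left
    ((√((n : ℝ) + 1) : ℝ) : ℂ)).add ((hasSum_expCoeff b ξ m n).mul_left (conj ξ))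
  simp only [expCoeff_creation] at h1
  have h := h1.unique h2
  have h0 : ((√(m : ℝ) : ℝ) : ℂ) * expCoeff ξ (m - 1) n 0
      = ((√((n : ℝ) + 1) : ℝ) : ℂ) * expCoeff ξ m (n + 1) 0 := by
    have := creation_apply (Finsupp.single n 1) m
    simp [creation, Finsupp.single_apply] at this
    simp [expCoeff, Finsupp.single_apply, this]
  simp only [Finset.sum_range_one] at h
  linear_combination h + h0

theorem dispElem_zero_zero (b : HilbertBasis ℕ ℂ H) (ξ : ℂ) :
    dispElem b ξ 0 0 = Complex.exp (-(ξ * conj ξ) / 2) := by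
  refine (hasSum_expCoeff b ξ 0 0).unique ?_
  rw [← add_zero (Complex.exp _)]
  refine HasSum.even_add_odd ?_ ?_
  · simp only [expCoeff_zero_zero_even]
    have := NormedSpace.exp_series_hasSum_exp' (𝕂 := ℂ) (-(ξ * conj ξ) / 2)
    simpa [Complex.exp_eq_exp_ℂ] using this
  · simp only [expCoeff_zero_zero_odd]
    exact hasSum_zero

/-- The two ladder relations determine an array from its corner. -/
theorem eq_zero_of_ladder_relations {A : ℕ → ℕ → ℂ} {η ζ : ℂ}
    (h1 : ∀ m n : ℕ, ((√((m : ℝ) + 1) : ℝ) : ℂ) * A (m + 1) n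
      = ((√(n : ℝ) : ℝ) : ℂ) * A m (n - 1) + η * A m n)
    (h2 : ∀ m n : ℕ, ((√(m : ℝ) : ℝ) : ℂ) * A (m - 1) n
      = ((√((n : ℝ) + 1) : ℝ) : ℂ) * A m (n + 1) + ζ * A m n)
    (h0 : A 0 0 = 0) (m n : ℕ) : A m n = 0 := by
  have hs : ∀ m : ℕ, ((√((m : ℝ) + 1) : ℝ) : ℂ) ≠ 0 := fun m => by
    rw [Complex.ofReal_ne_zero]; positivity
  have hrow : ∀ n, A 0 n = 0 := by
    intro n
    induction n with
    | zero => exact h0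
    | succ n ih =>
      have := h2 0 n
      simp only [Nat.cast_zero, Real.sqrt_zero, Complex.ofReal_zero, ih, mul_zero,
        add_zero] at this
      exact (mul_eq_zero.1 this.symm).resolve_left (hs n)
  induction m generalizing n with
  | zero => exact hrow n
  | succ m ih =>
    have := h1 m n
    rw [ih, ih, mul_zero, mul_zero, add_zero] at this
    exact (mul_eq_zero.1 this).resolve_left (hs m)

end

/-! ### Coherent vectors -/

theorem hasSum_congr {ι M : Type*} [AddCommMonoid M] [TopologicalSpace M] {f g : ι → M} {x y : M}
    (h : HasSum f x) (hf : ∀ i, g i = f i)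
    (hx : y = x) : HasSum g y := by
  rw [hx, show g = f from funext hf]
  exact h

theorem sqrt_succ_mul_coherentCoeff (α : ℂ) (n : ℕ) :
    ((√((n : ℝ) + 1) : ℝ) : ℂ) * (α ^ (n + 1) * ((√((n + 1).factorial : ℝ) : ℝ) : ℂ)⁻¹)
      = α * (α ^ n * ((√(n.factorial : ℝ) : ℝ) : ℂ)⁻¹) := by
  have h1 : ((√((n : ℝ) + 1) : ℝ) : ℂ) ≠ 0 := by
    rw [Complex.ofReal_ne_zero]; positivity
  rw [Nat.factorial_succ, Nat.cast_mul, Real.sqrt_mul (by positivity), Complex.ofReal_mul,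
    mul_inv, Nat.cast_succ, pow_succ]
  field_simp

theorem memℓp_coherentCoeff (α : ℂ) :
    Memℓp (fun n : ℕ => α ^ n * ((√(n.factorial : ℝ) : ℝ) : ℂ)⁻¹) 2 := by
  refine memℓp_gen ?_
  have h := Real.summable_pow_div_factorial (‖α‖ ^ 2)
  refine h.congr fun n => ?_
  have : (2 : ℝ≥0∞).toReal = ((2 : ℕ) : ℝ) := by norm_num
  rw [this, Real.rpow_natCast, norm_mul, norm_pow, norm_inv, Complex.norm_real,
    Real.norm_of_nonneg (Real.sqrt_nonneg _), mul_pow, inv_pow, Real.sq_sqrt (by positivity),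
    ← pow_mul, ← pow_mul, mul_comm 2 n, div_eq_mul_inv]

/-- The unnormalised coherent vector `∑ n, (αⁿ / √n!) |n⟩`. -/
def coherent (b : HilbertBasis ℕ ℂ H) (α : ℂ) : H :=
  b.repr.symm ⟨fun n : ℕ => α ^ n * ((√(n.factorial : ℝ) : ℝ) : ℂ)⁻¹, memℓp_coherentCoeff α⟩

theorem inner_fock_coherent (b : HilbertBasis ℕ ℂ H) (α : ℂ) (n : ℕ) :
    ⟪b n, coherent b α⟫_ℂ = α ^ n * ((√(n.factorial : ℝ) : ℝ) : ℂ)⁻¹ := by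
  rw [← HilbertBasis.repr_apply_apply, coherent, LinearIsometryEquiv.apply_symm_apply]

theorem hasSum_inner_coherent (b : HilbertBasis ℕ ℂ H) (α : ℂ) (v : H) :
    HasSum (fun n => conj α ^ n * (((√(n.factorial : ℝ) : ℝ) : ℂ)⁻¹ * ⟪b n, v⟫_ℂ))
      ⟪coherent b α, v⟫_ℂ := by
  refine hasSum_congr (b.hasSum_inner_mul_inner (coherent b α) v) (fun n => ?_) rfl
  rw [← inner_conj_symm (coherent b α) (b n), inner_fock_coherent, map_mul, map_pow, map_inv₀,
    Complex.conj_ofReal, mul_assoc]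

theorem inner_coherent_coherent (b : HilbertBasis ℕ ℂ H) (β α : ℂ) :
    ⟪coherent b β, coherent b α⟫_ℂ = Complex.exp (conj β * α) := by
  refine (hasSum_inner_coherent b β (coherent b α)).unique ?_
  have := NormedSpace.exp_series_hasSum_exp' (𝕂 := ℂ) (conj β * α)
  rw [Complex.exp_eq_exp_ℂ]
  refine hasSum_congr this (fun n => ?_) rfl
  have h : ((√(n.factorial : ℝ) : ℝ) : ℂ)⁻¹ * ((√(n.factorial : ℝ) : ℝ) : ℂ)⁻¹
      = (n.factorial : ℂ)⁻¹ := by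
    rw [← mul_inv, ← Complex.ofReal_mul, Real.mul_self_sqrt (by positivity), Complex.ofReal_natCast]
  rw [inner_fock_coherent, smul_eq_mul, ← h]
  ring

/-- Coherent vectors separate points, since `⟪e_α, v⟫` is an entire function of `α*` whose Taylor
coefficients are the Fock coefficients of `v`, up to the factors `√n!`. -/
theorem eq_zero_of_inner_coherent (b : HilbertBasis ℕ ℂ H) {v : H}
    (h : ∀ α, ⟪coherent b α, v⟫_ℂ = 0) : v = 0 := by
  have hs : HasFPowerSeriesAt (0 : ℂ → ℂ) (FormalMultilinearSeries.ofScalars ℂ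
      (fun n : ℕ => ((√(n.factorial : ℝ) : ℝ) : ℂ)⁻¹ * ⟪b n, v⟫_ℂ)) 0 := by
    rw [hasFPowerSeriesAt_iff]
    refine Eventually.of_forall fun z => ?_
    have := hasSum_inner_coherent b (conj z) v
    rw [h, Complex.conj_conj] at this
    simpa [FormalMultilinearSeries.coeff_ofScalars] using this
  have h0 := FormalMultilinearSeries.ofScalars_series_eq_zero (E := ℂ) |>.1 hs.eq_zero
  have hb : b.repr v = 0 := by
    ext n
    have := congrFun h0 n
    rw [HilbertBasis.repr_apply_apply]
    refine (mul_eq_zero.1 this).resolve_left (inv_ne_zero ?_)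
    rw [Complex.ofReal_ne_zero]
    positivity
  simpa using hb

theorem dense_span_fock (b : HilbertBasis ℕ ℂ H) :
    Dense (Submodule.span ℂ (Set.range b) : Set H) :=
  Submodule.dense_iff_topologicalClosure_eq_top.2 b.dense_span

/-- Two bounded sesquilinear forms which agree on a total set of vectors are equal. -/
theorem sesqForm_ext {S : Set H} (hS : Dense (Submodule.span ℂ S : Set H))
    {F G : H →L⋆[ℂ] H →L[ℂ] ℂ} (h : ∀ y ∈ S, ∀ x ∈ S, F y x = G y x) : F = G :=
  ContinuousLinearMap.ext_on hS fun y hy => ContinuousLinearMap.ext_on hS fun x hx => h y hy x hx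

/-- For a bounded family of functionals, continuity in the parameter can be tested on a total
set. -/
theorem continuous_apply_of_dense {S : Set H} (hS : Dense (Submodule.span ℂ S : Set H))
    {f : ℂ → H →L[ℂ] ℂ} {c : ℝ} (hc : ∀ ξ v, ‖f ξ v‖ ≤ c * ‖v‖)
    (h : ∀ v ∈ S, Continuous fun ξ => f ξ v) (v : H) : Continuous fun ξ => f ξ v := by
  have hspan : ∀ v ∈ Submodule.span ℂ S, Continuous fun ξ => f ξ v := by
    intro v hv
    induction hv using Submodule.span_induction with
    | mem v hv => exact h v hv
    | zero => simpa using continuous_const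
    | add u v _ _ hu hv =>
      simp only [map_add]
      exact hu.add hv
    | smul a v _ hv =>
      simp only [map_smul]
      exact hv.const_smul a
  refine continuous_of_uniform_approx_of_continuous fun u hu => ?_
  obtain ⟨ε, hε, hεu⟩ := Metric.mem_uniformity_dist.1 hu
  obtain ⟨w, hw, hvw⟩ := Metric.dense_iff.1 hS v (ε / (|c| + 1)) (by positivity)
  refine ⟨fun ξ => f ξ w, hspan w hvw, fun ξ => hεu ?_⟩
  rw [Metric.mem_ball, dist_comm, dist_eq_norm] at hw
  rw [dist_eq_norm, ← map_sub]
  have hpos : 0 < |c| + 1 := by positivity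
  calc ‖f ξ (v - w)‖ ≤ c * ‖v - w‖ := hc ξ _
    _ ≤ (|c| + 1) * ‖v - w‖ := by
      refine mul_le_mul_of_nonneg_right ?_ (norm_nonneg _)
      linarith [le_abs_self c]
    _ < (|c| + 1) * (ε / (|c| + 1)) := by gcongr
    _ = ε := by field_simp

section

variable [CompleteSpace H]

theorem dense_span_coherent (b : HilbertBasis ℕ ℂ H) :
    Dense (Submodule.span ℂ (Set.range (coherent b)) : Set H) := by
  rw [Submodule.dense_iff_topologicalClosure_eq_top, Submodule.topologicalClosure_eq_top_iff,
    Submodule.eq_bot_iff]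
  intro v hv
  refine eq_zero_of_inner_coherent b fun α => ?_
  exact (Submodule.mem_orthogonal _ _).1 hv _ (Submodule.subset_span ⟨α, rfl⟩)

theorem norm_displacement_apply (b : HilbertBasis ℕ ℂ H) (ξ : ℂ) (v : H) :
    ‖displacement b ξ v‖ = ‖v‖ := by
  simp [displacement]

theorem dispElem_zero_left (b : HilbertBasis ℕ ℂ H) (ξ : ℂ) (n : ℕ) :
    dispElem b ξ 0 n = (-conj ξ) ^ n * ((√(n.factorial : ℝ) : ℝ) : ℂ)⁻¹
      * Complex.exp (-(ξ * conj ξ) / 2) := by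
  induction n with
  | zero => simp [dispElem_zero_zero]
  | succ n ih =>
    have h := dispElem_creation b ξ 0 n
    have h1 : ((√((n : ℝ) + 1) : ℝ) : ℂ) ≠ 0 := by
      rw [Complex.ofReal_ne_zero]; positivity
    have h2 := sqrt_succ_mul_coherentCoeff (-conj ξ) n
    simp only [Nat.cast_zero, Real.sqrt_zero, Complex.ofReal_zero, zero_mul] at h
    refine mul_left_cancel₀ h1 ?_
    rw [← mul_assoc, h2]
    rw [ih] at h
    linear_combination -h

/-- The Fock coefficients of `D(ξ) e_α`, expanded along `e_α = ∑ n, (αⁿ / √n!) |n⟩`. -/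
theorem inner_fock_displacement_coherent (b : HilbertBasis ℕ ℂ H) (ξ α : ℂ) (m : ℕ) :
    HasSum (fun n => α ^ n * ((√(n.factorial : ℝ) : ℝ) : ℂ)⁻¹ * dispElem b ξ m n)
      ⟪b m, displacement b ξ (coherent b α)⟫_ℂ := by
  have h := (b.hasSum_repr (coherent b α)).mapL ((innerSL ℂ (b m)).comp (displacement b ξ))
  simp only [ContinuousLinearMap.comp_apply, innerSL_apply_apply, map_smul,
    HilbertBasis.repr_apply_apply, inner_fock_coherent] at h
  exact h

/-- `D(ξ)` maps coherent vectors to coherent vectors. The Fock coefficients `v m` of `D(ξ) e_α`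
satisfy the recursion `a v = (α + ξ) v` which characterises multiples of `e_{α+ξ}`, and `v 0` is the
sum of an exponential series. -/
theorem displacement_coherent (b : HilbertBasis ℕ ℂ H) (ξ α : ℂ) :
    displacement b ξ (coherent b α)
      = Complex.exp (-(ξ * conj ξ) / 2 - conj ξ * α) • coherent b (α + ξ) := by
  set v : ℕ → ℂ := fun m => ⟪b m, displacement b ξ (coherent b α)⟫_ℂ with hv
  have hsum := inner_fock_displacement_coherent b ξ α
  have hrec : ∀ m : ℕ, ((√((m : ℝ) + 1) : ℝ) : ℂ) * v (m + 1) = (α + ξ) * v m := by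
    intro m
    refine ((hsum (m + 1)).mul_left _).unique ?_
    have h1 : HasSum (fun n : ℕ => α ^ n * ((√(n.factorial : ℝ) : ℝ) : ℂ)⁻¹
        * (((√(n : ℝ) : ℝ) : ℂ) * dispElem b ξ m (n - 1))) (α * v m) := by
      rw [← hasSum_nat_add_iff' 1]
      simp only [Finset.sum_range_one, Nat.cast_zero, Real.sqrt_zero, Complex.ofReal_zero,
        zero_mul, mul_zero, sub_zero, Nat.add_sub_cancel]
      refine hasSum_congr ((hsum m).mul_left α) (fun n => ?_) rfl
      have := sqrt_succ_mul_coherentCoeff α n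
      rw [Nat.cast_succ]
      linear_combination dispElem b ξ m n * this
    refine hasSum_congr (h1.add ((hsum m).mul_left ξ)) (fun n => ?_) (add_mul _ _ _)
    linear_combination α ^ n * ((√(n.factorial : ℝ) : ℝ) : ℂ)⁻¹ * dispElem_annihilation b ξ m n
  have h0 : v 0 = Complex.exp (-(ξ * conj ξ) / 2 - conj ξ * α) := by
    refine (hsum 0).unique ?_
    have := (NormedSpace.exp_series_hasSum_exp' (𝕂 := ℂ) (-conj ξ * α)).mul_right
      (Complex.exp (-(ξ * conj ξ) / 2))
    rw [← Complex.exp_eq_exp_ℂ, ← Complex.exp_add] at this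
    refine hasSum_congr this (fun n => ?_) ?_
    · have h : ((√(n.factorial : ℝ) : ℝ) : ℂ)⁻¹ * ((√(n.factorial : ℝ) : ℝ) : ℂ)⁻¹
          = (n.factorial : ℂ)⁻¹ := by
        rw [← mul_inv, ← Complex.ofReal_mul, Real.mul_self_sqrt (by positivity),
          Complex.ofReal_natCast]
      rw [dispElem_zero_left, smul_eq_mul, ← h, mul_pow]
      ring
    · congr 1
      ring
  have hall : ∀ m, v m = Complex.exp (-(ξ * conj ξ) / 2 - conj ξ * α)
      * ((α + ξ) ^ m * ((√(m.factorial : ℝ) : ℝ) : ℂ)⁻¹) := by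
    intro m
    induction m with
    | zero => simp [h0]
    | succ m ih =>
      have h1 : ((√((m : ℝ) + 1) : ℝ) : ℂ) ≠ 0 := by
        rw [Complex.ofReal_ne_zero]; positivity
      refine mul_left_cancel₀ h1 ?_
      rw [hrec, mul_left_comm, sqrt_succ_mul_coherentCoeff, ih]
      ring
  refine b.repr.injective ?_
  ext m
  rw [HilbertBasis.repr_apply_apply, HilbertBasis.repr_apply_apply, inner_smul_right,
    inner_fock_coherent]
  exact hall m

theorem inner_coherent_displacement_coherent (b : HilbertBasis ℕ ℂ H) (ξ β α : ℂ) :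
    ⟪coherent b β, displacement b ξ (coherent b α)⟫_ℂ
      = Complex.exp (-(ξ * conj ξ) / 2 - conj ξ * α + conj β * (α + ξ)) := by
  rw [displacement_coherent, inner_smul_right, inner_coherent_coherent, ← Complex.exp_add]

end

/-! ### The Kraus operators in the Fock basis -/

/-- Summation of a triangular double series by columns and by rows. -/
theorem hasSum_triangular {E : Type*} [NormedAddCommGroup E] {f : ℕ → ℕ → E} {g : ℕ → E} {a : E}
    (hs : Summable (Function.uncurry f)) (hcol : ∀ j, HasSum (f j) (g j)) (hg : HasSum g a)
    (h0 : ∀ j l, l < j → f j l = 0) :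
    HasSum (fun l => ∑ j ∈ Finset.range (l + 1), f j l) a := by
  have hval : ∑' p, Function.uncurry f p = a := (hs.hasSum.prod_fiberwise hcol).unique hg
  have hswap : HasSum (Function.uncurry f ∘ Equiv.prodComm ℕ ℕ) a := by
    rw [Equiv.hasSum_iff, ← hval]
    exact hs.hasSum
  refine hswap.prod_fiberwise fun l => ?_
  refine hasSum_sum_of_ne_finset_zero fun j hj => ?_
  rw [Finset.mem_range, not_lt] at hj
  exact h0 j l (Nat.lt_of_succ_le hj)

/-- The coefficient of `|l-n⟩⟨n|` in the Kraus operator `T_l(κ)`; it vanishes for `n > l`. -/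
def krausCoeff (κ : ℝ) (l n : ℕ) : ℝ :=
  (√(1 + κ ^ 2))⁻¹ *
    ((√(1 + κ ^ 2))⁻¹ ^ n * (√(1 + (κ ^ 2)⁻¹))⁻¹ ^ (l - n) * √(l.choose n : ℝ))

theorem krausCoeff_eq_zero (κ : ℝ) {l n : ℕ} (h : l < n) : krausCoeff κ l n = 0 := by
  simp [krausCoeff, Nat.choose_eq_zero_of_lt h]

theorem inv_sqrt_inv_eq {κ : ℝ} (hκ : 0 < κ) :
    (√(1 + (κ ^ 2)⁻¹))⁻¹ = κ * (√(1 + κ ^ 2))⁻¹ := by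
  have h : 1 + (κ ^ 2)⁻¹ = (1 + κ ^ 2) / κ ^ 2 := by
    field_simp
    ring
  rw [h, Real.sqrt_div (by positivity), Real.sqrt_sq hκ.le, inv_div, div_eq_mul_inv]

theorem inv_sqrt_sq (κ : ℝ) : (√(1 + κ ^ 2))⁻¹ ^ 2 = (1 + κ ^ 2)⁻¹ := by
  rw [inv_pow, Real.sq_sqrt (by positivity)]

theorem krausCoeff_sq {κ : ℝ} (hκ : 0 < κ) (l n : ℕ) :
    krausCoeff κ l n ^ 2 = (1 + κ ^ 2)⁻¹ * (κ ^ 2)⁻¹ ^ n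
      * ((l.choose n : ℝ) * (κ ^ 2 * (1 + κ ^ 2)⁻¹) ^ l) := by
  rcases lt_or_ge l n with h | h
  · simp [krausCoeff_eq_zero κ h, Nat.choose_eq_zero_of_lt h]
  · obtain ⟨p, rfl⟩ := Nat.exists_eq_add_of_le h
    rw [krausCoeff, inv_sqrt_inv_eq hκ, Nat.add_sub_cancel_left]
    simp only [mul_pow, ← pow_mul, mul_comm _ 2]
    simp only [pow_mul, inv_sqrt_sq, Real.sq_sqrt (Nat.cast_nonneg _)]
    have : κ ^ 2 ≠ 0 := by positivity
    rw [pow_add, pow_add, inv_pow (κ ^ 2)]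
    field_simp

theorem hasSum_choose_mul_pow {𝕜 : Type*} [NormedField 𝕜] [CompleteSpace 𝕜] (j : ℕ) {q : 𝕜}
    (hq : ‖q‖ < 1) :
    HasSum (fun l : ℕ => (l.choose j : 𝕜) * q ^ l) (q ^ j / (1 - q) ^ (j + 1)) := by
  rw [← hasSum_nat_add_iff' j, Finset.sum_eq_zero, sub_zero]
  · have h := (hasSum_choose_mul_geometric_of_norm_lt_one j hq).mul_left (q ^ j)
    rw [mul_one_div] at h
    refine hasSum_congr h (fun p => ?_) rfl
    rw [pow_add]
    ring
  · intro i hi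
    rw [Nat.choose_eq_zero_of_lt (Finset.mem_range.1 hi), Nat.cast_zero, zero_mul]

/-- The columns of the Kraus operators are normalised: `∑ l, ‖T_l |n⟩‖² = 1`. -/
theorem hasSum_krausCoeff_sq {κ : ℝ} (hκ : 0 < κ) (n : ℕ) :
    HasSum (fun l => krausCoeff κ l n ^ 2) 1 := by
  simp only [krausCoeff_sq hκ]
  have hq : ‖κ ^ 2 * (1 + κ ^ 2)⁻¹‖ < 1 := by
    rw [Real.norm_of_nonneg (by positivity), ← div_eq_mul_inv, div_lt_one (by positivity)]
    linarith
  refine hasSum_congr ((hasSum_choose_mul_pow n hq).mul_left ((1 + κ ^ 2)⁻¹ * (κ ^ 2)⁻¹ ^ n))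
    (fun _ => rfl) ?_
  have h1 : 1 - κ ^ 2 * (1 + κ ^ 2)⁻¹ = (1 + κ ^ 2)⁻¹ := by
    field_simp
    ring
  simp only [h1, mul_pow, inv_pow, pow_succ _ n]
  field_simp

theorem kraus_apply (b : HilbertBasis ℕ ℂ H) (κ : ℝ) (l : ℕ) (v : H) :
    kraus b κ l v = ∑ j ∈ Finset.range (l + 1),
      ((krausCoeff κ l (l - j) : ℂ) * ⟪b (l - j), v⟫_ℂ) • b j := by
  rw [← Finset.sum_range_reflect]
  simp only [kraus, krausCoeff, smul_apply, sum_apply, Finset.smul_sum,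
    InnerProductSpace.rankOne_apply, smul_smul, Nat.add_sub_cancel]
  refine Finset.sum_congr rfl fun j hj => ?_
  have hj' : j ≤ l := Nat.lt_succ_iff.1 (Finset.mem_range.1 hj)
  rw [Nat.sub_sub_self hj']
  push_cast
  rfl

theorem kraus_apply_fock (b : HilbertBasis ℕ ℂ H) (κ : ℝ) (l n : ℕ) :
    kraus b κ l (b n) = (krausCoeff κ l n : ℂ) • b (l - n) := by
  rcases lt_or_ge l n with h | h
  · rw [krausCoeff_eq_zero κ h, kraus_apply, Complex.ofReal_zero, zero_smul]
    refine Finset.sum_eq_zero fun j _ => ?_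
    rw [b.orthonormal.2 (by omega), mul_zero, zero_smul]
  · rw [kraus_apply, Finset.sum_eq_single (l - n)]
    · rw [Nat.sub_sub_self h, inner_self_eq_norm_sq_to_K, b.orthonormal.1]
      simp
    · intro j hj hne
      have hj' : j ≤ l := Nat.lt_succ_iff.1 (Finset.mem_range.1 hj)
      rw [b.orthonormal.2 (by omega), mul_zero, zero_smul]
    · intro h'
      exact absurd (Finset.mem_range.2 (by omega)) h'

theorem norm_sq_kraus_apply (b : HilbertBasis ℕ ℂ H) (κ : ℝ) (l : ℕ) (v : H) :
    ‖kraus b κ l v‖ ^ 2 = ∑ n ∈ Finset.range (l + 1), krausCoeff κ l n ^ 2 * ‖⟪b n, v⟫_ℂ‖ ^ 2 := by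
  rw [← Finset.sum_range_reflect, ← Complex.ofReal_inj]
  have h := inner_self_eq_norm_sq_to_K (𝕜 := ℂ) (kraus b κ l v)
  rw [kraus_apply, b.orthonormal.inner_sum, ← kraus_apply] at h
  refine Eq.trans (by exact_mod_cast h.symm) ?_
  rw [Complex.ofReal_sum]
  refine Finset.sum_congr rfl fun j _ => ?_
  rw [Nat.add_sub_cancel, map_mul, Complex.conj_ofReal, mul_mul_mul_comm, Complex.conj_mul']
  push_cast
  ring

theorem hasSum_norm_sq_inner (b : HilbertBasis ℕ ℂ H) (v : H) :
    HasSum (fun n => ‖⟪b n, v⟫_ℂ‖ ^ 2) (‖v‖ ^ 2) := by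
  have h := b.hasSum_inner_mul_inner v v
  rw [inner_self_eq_norm_sq_to_K] at h
  rw [← Complex.hasSum_ofReal]
  refine hasSum_congr h (fun n => ?_) (by simp)
  rw [← inner_conj_symm v (b n), Complex.conj_mul']
  push_cast
  rfl

/-- The Kraus operators are trace preserving: `∑ l, ‖T_l v‖² = ‖v‖²`. -/
theorem hasSum_norm_sq_kraus (b : HilbertBasis ℕ ℂ H) {κ : ℝ} (hκ : 0 < κ) (v : H) :
    HasSum (fun l => ‖kraus b κ l v‖ ^ 2) (‖v‖ ^ 2) := by
  have hcol : ∀ n, HasSum (fun l => krausCoeff κ l n ^ 2 * ‖⟪b n, v⟫_ℂ‖ ^ 2)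
      (‖⟪b n, v⟫_ℂ‖ ^ 2) := fun n => by
    simpa using (hasSum_krausCoeff_sq hκ n).mul_right (‖⟪b n, v⟫_ℂ‖ ^ 2)
  simp only [norm_sq_kraus_apply]
  refine hasSum_triangular (f := fun n l => krausCoeff κ l n ^ 2 * ‖⟪b n, v⟫_ℂ‖ ^ 2) ?_ hcol
    (hasSum_norm_sq_inner b v) fun n l h => by simp [krausCoeff_eq_zero κ h]
  rw [summable_prod_of_nonneg (fun p => by simp only [Function.uncurry]; positivity)]
  refine ⟨fun n => (hcol n).summable, ?_⟩
  simp only [Function.uncurry, (hcol _).tsum_eq]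
  exact (hasSum_norm_sq_inner b v).summable

theorem summable_mul_of_hasSum_sq {f g : ℕ → ℝ} {a c : ℝ} (hf : HasSum (fun i => f i ^ 2) a)
    (hg : HasSum (fun i => g i ^ 2) c) (hf0 : ∀ i, 0 ≤ f i) (hg0 : ∀ i, 0 ≤ g i) :
    Summable (fun i => f i * g i) :=
  Summable.of_nonneg_of_le (fun i => mul_nonneg (hf0 i) (hg0 i))
    (fun i => by nlinarith [sq_nonneg (f i - g i), sq_nonneg (f i), sq_nonneg (g i)])
    (hf.summable.add hg.summable)

/-- The Cauchy-Schwarz inequality for series. -/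
theorem tsum_mul_le_of_hasSum_sq {f g : ℕ → ℝ} {a c : ℝ} (hf : HasSum (fun i => f i ^ 2) (a ^ 2))
    (hg : HasSum (fun i => g i ^ 2) (c ^ 2)) (hf0 : ∀ i, 0 ≤ f i) (hg0 : ∀ i, 0 ≤ g i)
    (ha : 0 ≤ a) (hc : 0 ≤ c) : ∑' i, f i * g i ≤ a * c := by
  have h := Real.inner_le_Lp_mul_Lq_tsum_of_nonneg (p := 2) (q := 2)
    ⟨by norm_num, by norm_num, by norm_num⟩ hf0 hg0
  simp only [Real.rpow_two] at h
  have h' := h hf.summable hg.summable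
  rwa [hf.tsum_eq, hg.tsum_eq, ← Real.sqrt_eq_rpow, ← Real.sqrt_eq_rpow, Real.sqrt_sq ha,
    Real.sqrt_sq hc] at h'

theorem summable_norm_kraus_mul_norm_kraus (b : HilbertBasis ℕ ℂ H) {κ : ℝ} (hκ : 0 < κ)
    (x y : H) : Summable (fun l => ‖kraus b κ l x‖ * ‖kraus b κ l y‖) :=
  summable_mul_of_hasSum_sq (hasSum_norm_sq_kraus b hκ x) (hasSum_norm_sq_kraus b hκ y)
    (fun _ => norm_nonneg _) (fun _ => norm_nonneg _)

theorem tsum_norm_kraus_mul_norm_kraus_le (b : HilbertBasis ℕ ℂ H) {κ : ℝ} (hκ : 0 < κ)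
    (x y : H) : ∑' l, ‖kraus b κ l x‖ * ‖kraus b κ l y‖ ≤ ‖x‖ * ‖y‖ :=
  tsum_mul_le_of_hasSum_sq (hasSum_norm_sq_kraus b hκ x) (hasSum_norm_sq_kraus b hκ y)
    (fun _ => norm_nonneg _) (fun _ => norm_nonneg _) (norm_nonneg _) (norm_nonneg _)

/-! ### Conjugating the displacement operators with the Kraus operators -/

/-- `a T_l = κ T_l a†`, in coefficients. -/
theorem krausCoeff_succ_right {κ : ℝ} (hκ : 0 < κ) (l n : ℕ) :
    κ * (√((n : ℝ) + 1) * krausCoeff κ l (n + 1)) = √((l - n : ℕ) : ℝ) * krausCoeff κ l n := by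
  rcases lt_trichotomy l n with h | rfl | h
  · rw [krausCoeff_eq_zero κ h, krausCoeff_eq_zero κ (h.trans (Nat.lt_succ_self n))]
    simp
  · rw [krausCoeff_eq_zero κ (Nat.lt_succ_self l)]
    simp
  · obtain ⟨p, rfl⟩ := Nat.exists_eq_add_of_lt h
    have hc : √((n : ℝ) + 1) * √((n + p + 1).choose (n + 1) : ℝ)
        = √((p : ℝ) + 1) * √((n + p + 1).choose n : ℝ) := by
      rw [← Real.sqrt_mul (by positivity), ← Real.sqrt_mul (by positivity)]
      congr 1
      have := Nat.choose_succ_right_eq (n + p + 1) n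
      rw [show n + p + 1 - n = p + 1 by omega] at this
      have h' : ((n + p + 1).choose (n + 1) : ℝ) * ((n : ℝ) + 1)
          = ((n + p + 1).choose n : ℝ) * ((p : ℝ) + 1) := by exact_mod_cast this
      linarith
    rw [krausCoeff, krausCoeff, show n + p + 1 - (n + 1) = p by omega,
      show n + p + 1 - n = p + 1 by omega, pow_succ _ n, pow_succ _ p, inv_sqrt_inv_eq hκ]
    push_cast
    linear_combination (κ * (√(1 + κ ^ 2))⁻¹ * ((√(1 + κ ^ 2))⁻¹ ^ n * (√(1 + κ ^ 2))⁻¹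
      * (κ * (√(1 + κ ^ 2))⁻¹) ^ p)) * hc

/-- `T_{l+1} a† = s √(l+1) T_l` with `s = 1 / √(1+κ²)`, in coefficients. -/
theorem krausCoeff_succ_succ (κ : ℝ) (l n : ℕ) :
    √((n : ℝ) + 1) * krausCoeff κ (l + 1) (n + 1)
      = (√(1 + κ ^ 2))⁻¹ * (√((l : ℝ) + 1) * krausCoeff κ l n) := by
  have hc : √((n : ℝ) + 1) * √((l + 1).choose (n + 1) : ℝ)
      = √((l : ℝ) + 1) * √(l.choose n : ℝ) := by
    rw [← Real.sqrt_mul (by positivity), ← Real.sqrt_mul (by positivity)]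
    congr 1
    have h' : ((l : ℝ) + 1) * (l.choose n : ℝ) = ((l + 1).choose (n + 1) : ℝ) * ((n : ℝ) + 1) := by
      exact_mod_cast Nat.add_one_mul_choose_eq l n
    linarith
  rw [krausCoeff, krausCoeff, Nat.add_sub_add_right, pow_succ _ n]
  linear_combination ((√(1 + κ ^ 2))⁻¹ * ((√(1 + κ ^ 2))⁻¹ ^ n * (√(1 + κ ^ 2))⁻¹
    * (√(1 + (κ ^ 2)⁻¹))⁻¹ ^ (l - n))) * hc

theorem krausCoeff_succ_left (κ : ℝ) {l m : ℕ} (h : m ≤ l) :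
    √((l - m : ℕ) + 1 : ℝ) * krausCoeff κ (l + 1) m
      = (√(1 + (κ ^ 2)⁻¹))⁻¹ * (√((l : ℝ) + 1) * krausCoeff κ l m) := by
  have hc : √((l - m : ℕ) + 1 : ℝ) * √((l + 1).choose m : ℝ)
      = √((l : ℝ) + 1) * √(l.choose m : ℝ) := by
    rw [← Real.sqrt_mul (by positivity), ← Real.sqrt_mul (by positivity)]
    congr 1
    have := Nat.choose_mul_succ_eq l m
    rw [Nat.succ_sub h] at this
    have h' : (l.choose m : ℝ) * ((l : ℝ) + 1)
        = ((l + 1).choose m : ℝ) * (((l - m : ℕ) : ℝ) + 1) := by exact_mod_cast this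
    linarith
  rw [krausCoeff, krausCoeff, Nat.sub_add_comm h, pow_succ _ (l - m)]
  linear_combination ((√(1 + κ ^ 2))⁻¹ * ((√(1 + κ ^ 2))⁻¹ ^ m * ((√(1 + (κ ^ 2)⁻¹))⁻¹ ^ (l - m)
    * (√(1 + (κ ^ 2)⁻¹))⁻¹))) * hc

/-- `√(l+1) T_{l+1} = s T_l a + t a† T_l` with `s = 1 / √(1+κ²)` and `t = 1 / √(1+κ⁻²)`, in
coefficients. -/
theorem krausCoeff_three_term (κ : ℝ) {l m : ℕ} (h : m ≤ l) :
    √((l : ℝ) + 1) * krausCoeff κ (l + 1) m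
      = (√(1 + κ ^ 2))⁻¹ * (√(m : ℝ) * krausCoeff κ l (m - 1))
        + (√(1 + (κ ^ 2)⁻¹))⁻¹ * (√((l - m : ℕ) + 1 : ℝ) * krausCoeff κ l m) := by
  have hl : √((l : ℝ) + 1) ≠ 0 := by positivity
  have h1 := krausCoeff_succ_left κ h
  have h2 : √(m : ℝ) * (√(m : ℝ) * krausCoeff κ (l + 1) m) = √(m : ℝ) * ((√(1 + κ ^ 2))⁻¹ *
      (√((l : ℝ) + 1) * krausCoeff κ l (m - 1))) := by
    rcases m with _ | m
    · simp
    · have := krausCoeff_succ_succ κ l m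
      rw [Nat.cast_succ, this, Nat.add_sub_cancel]
  have e1 : √((l : ℝ) + 1) * √((l : ℝ) + 1) = (l : ℝ) + 1 := Real.mul_self_sqrt (by positivity)
  have e2 : √(m : ℝ) * √(m : ℝ) = m := Real.mul_self_sqrt (by positivity)
  have e3 : √((l - m : ℕ) + 1 : ℝ) * √((l - m : ℕ) + 1 : ℝ) = (l : ℝ) - m + 1 := by
    rw [Real.mul_self_sqrt (by positivity), Nat.cast_sub h]
  refine mul_left_cancel₀ hl ?_
  linear_combination krausCoeff κ (l + 1) m * e1 - krausCoeff κ (l + 1) m * e2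
    - krausCoeff κ (l + 1) m * e3 + h2 + √((l - m : ℕ) + 1 : ℝ) * h1

/-- The matrix element `⟨m|T_l† X T_l|n⟩`, where `X` has the matrix elements `d`. -/
def krausConj (κ : ℝ) (d : ℕ → ℕ → ℂ) (m n l : ℕ) : ℂ :=
  krausCoeff κ l m * krausCoeff κ l n * d (l - m) (l - n)

/-- The effect of the ladder operators on `T_l† X T_l`, for an operator `X` with
`a X = X (a + ξ)`. -/
theorem krausConj_ladder {κ : ℝ} (hκ : 0 < κ) {d : ℕ → ℕ → ℂ} {ξ : ℂ}
    (hd : ∀ m n : ℕ, ((√((m : ℝ) + 1) : ℝ) : ℂ) * d (m + 1) n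
      = ((√(n : ℝ) : ℝ) : ℂ) * d m (n - 1) + ξ * d m n) (m n l : ℕ) :
    (((√(1 + (κ ^ 2)⁻¹))⁻¹ : ℝ) : ℂ) * (κ * (((√((n : ℝ) + 1) : ℝ) : ℂ) * krausConj κ d m (n + 1) l)
        + ξ * krausConj κ d m n l) * (((√(1 + κ ^ 2))⁻¹ : ℝ) : ℂ)
      = ((√((n : ℝ) + 1) : ℝ) : ℂ) * krausConj κ d m (n + 1) (l + 1)
        - (((√(1 + κ ^ 2))⁻¹ : ℝ) : ℂ) ^ 2
          * (((√(m : ℝ) : ℝ) : ℂ) * krausConj κ d (m - 1) n l) := by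
  have c2 : ((√((n : ℝ) + 1) : ℝ) : ℂ) * (krausCoeff κ (l + 1) (n + 1) : ℂ)
      = (((√(1 + κ ^ 2))⁻¹ : ℝ) : ℂ) * (((√((l : ℝ) + 1) : ℝ) : ℂ) * (krausCoeff κ l n : ℂ)) := by
    exact_mod_cast krausCoeff_succ_succ κ l n
  have c1 : (κ : ℂ) * (((√((n : ℝ) + 1) : ℝ) : ℂ) * (krausCoeff κ l (n + 1) : ℂ))
      = ((√((l - n : ℕ) : ℝ) : ℝ) : ℂ) * (krausCoeff κ l n : ℂ) := by
    exact_mod_cast krausCoeff_succ_right hκ l n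
  simp only [krausConj, Nat.add_sub_add_right]
  rcases lt_trichotomy m (l + 1) with h | rfl | h
  · have hm : m ≤ l := Nat.lt_succ_iff.1 h
    have c3 : ((√((l : ℝ) + 1) : ℝ) : ℂ) * (krausCoeff κ (l + 1) m : ℂ)
        = (((√(1 + κ ^ 2))⁻¹ : ℝ) : ℂ) * (((√(m : ℝ) : ℝ) : ℂ) * (krausCoeff κ l (m - 1) : ℂ))
          + (((√(1 + (κ ^ 2)⁻¹))⁻¹ : ℝ) : ℂ)
            * (((√((l - m : ℕ) + 1 : ℝ) : ℝ) : ℂ) * (krausCoeff κ l m : ℂ)) := by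
      exact_mod_cast krausCoeff_three_term κ hm
    have hd' := hd (l - m) (l - n)
    rw [show l + 1 - m = l - m + 1 by omega]
    rw [show l - (n + 1) = l - n - 1 by omega]
    have hm' : ((√(m : ℝ) : ℝ) : ℂ) * d (l - (m - 1)) (l - n)
        = ((√(m : ℝ) : ℝ) : ℂ) * d (l - m + 1) (l - n) := by
      rcases m with _ | m
      · simp
      · rw [show l - (m + 1 - 1) = l - (m + 1) + 1 by omega]
    linear_combination
      (((√(1 + (κ ^ 2)⁻¹))⁻¹ : ℝ) : ℂ) * (((√(1 + κ ^ 2))⁻¹ : ℝ) : ℂ) * krausCoeff κ l m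
          * d (l - m) (l - n - 1) * c1
        - (((√(1 + (κ ^ 2)⁻¹))⁻¹ : ℝ) : ℂ) * (((√(1 + κ ^ 2))⁻¹ : ℝ) : ℂ) * krausCoeff κ l m
          * krausCoeff κ l n * hd'
        - krausCoeff κ (l + 1) m * d (l - m + 1) (l - n) * c2
        - (((√(1 + κ ^ 2))⁻¹ : ℝ) : ℂ) * krausCoeff κ l n * d (l - m + 1) (l - n) * c3
        + (((√(1 + κ ^ 2))⁻¹ : ℝ) : ℂ) ^ 2 * krausCoeff κ l (m - 1) * krausCoeff κ l n * hm'
  · have c3 : ((√((l : ℝ) + 1) : ℝ) : ℂ) * (krausCoeff κ (l + 1) (l + 1) : ℂ)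
        = (((√(1 + κ ^ 2))⁻¹ : ℝ) : ℂ) * (((√((l : ℝ) + 1) : ℝ) : ℂ) * (krausCoeff κ l l : ℂ)) := by
      exact_mod_cast krausCoeff_succ_succ κ l l
    rw [krausCoeff_eq_zero κ (Nat.lt_succ_self l), Nat.add_sub_cancel, Nat.sub_self, Nat.sub_self,
      Nat.cast_succ, Complex.ofReal_zero]
    linear_combination -krausCoeff κ (l + 1) (l + 1) * d 0 (l - n) * c2
      - (((√(1 + κ ^ 2))⁻¹ : ℝ) : ℂ) * krausCoeff κ l n * d 0 (l - n) * c3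
  · rw [krausCoeff_eq_zero κ h, krausCoeff_eq_zero κ (show l < m by omega),
      krausCoeff_eq_zero κ (show l < m - 1 by omega)]
    simp


/-- If `a X = X (a + ξ)`, then `M = ∑ l, T_l† X T_l` satisfies `a† M = M (a† - κ ξ)`:
the shift of `l` in `krausConj_ladder` disappears in the sum. -/
theorem krausConj_sum_ladder {κ : ℝ} (hκ : 0 < κ) {d : ℕ → ℕ → ℂ} {ξ : ℂ}
    (hd : ∀ m n : ℕ, ((√((m : ℝ) + 1) : ℝ) : ℂ) * d (m + 1) n
      = ((√(n : ℝ) : ℝ) : ℂ) * d m (n - 1) + ξ * d m n)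
    {M : ℕ → ℕ → ℂ} (hM : ∀ m n, HasSum (krausConj κ d m n) (M m n)) (m n : ℕ) :
    ((√(m : ℝ) : ℝ) : ℂ) * M (m - 1) n
      = ((√((n : ℝ) + 1) : ℝ) : ℂ) * M m (n + 1) - κ * ξ * M m n := by
  have h0 : krausConj κ d m (n + 1) 0 = 0 := by
    simp [krausConj, krausCoeff_eq_zero κ (Nat.succ_pos n)]
  have hl := (((((hM m (n + 1)).mul_left ((√((n : ℝ) + 1) : ℝ) : ℂ)).mul_left (κ : ℂ)).add
    ((hM m n).mul_left ξ)).mul_left (((√(1 + (κ ^ 2)⁻¹))⁻¹ : ℝ) : ℂ)).mul_right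
      (((√(1 + κ ^ 2))⁻¹ : ℝ) : ℂ)
  have hr := (((hasSum_nat_add_iff' 1).2 (hM m (n + 1))).mul_left ((√((n : ℝ) + 1) : ℝ) : ℂ)).sub
    (((hM (m - 1) n).mul_left ((√(m : ℝ) : ℝ) : ℂ)).mul_left ((((√(1 + κ ^ 2))⁻¹ : ℝ) : ℂ) ^ 2))
  simp only [krausConj_ladder hκ hd] at hl
  have h := hl.unique hr
  have hs : (((√(1 + κ ^ 2))⁻¹ : ℝ) : ℂ) ^ 2 * (1 + (κ : ℂ) ^ 2) = 1 := by
    have h1 : (1 + κ ^ 2 : ℝ) ≠ 0 := by positivity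
    have h2 : (√(1 + κ ^ 2))⁻¹ ^ 2 * (1 + κ ^ 2) = 1 := by rw [inv_sqrt_sq, inv_mul_cancel₀ h1]
    exact_mod_cast h2
  have hs0 : (((√(1 + κ ^ 2))⁻¹ : ℝ) : ℂ) ^ 2 ≠ 0 := left_ne_zero_of_mul_eq_one hs
  rw [inv_sqrt_inv_eq hκ, Finset.sum_range_one, h0, Complex.ofReal_mul] at h
  refine mul_left_cancel₀ hs0 ?_
  linear_combination h - ((√((n : ℝ) + 1) : ℝ) : ℂ) * M m (n + 1) * hs

/-! ### The vacuum expectation value and a Laguerre generating function -/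

/-- `∑ l, qˡ ∑ j, (l choose j) zʲ / j! = exp (z q / (1 - q)) / (1 - q)`, the generating function of
the Laguerre polynomials. -/
theorem hasSum_laguerre (z : ℂ) {q : ℝ} (hq0 : 0 ≤ q) (hq : q < 1) :
    HasSum (fun l : ℕ => (q : ℂ) ^ l * ∑ j ∈ Finset.range (l + 1),
      (l.choose j : ℂ) * (z ^ j * (j.factorial : ℂ)⁻¹))
      ((1 - (q : ℂ))⁻¹ * Complex.exp (z * q / (1 - q))) := by
  have hq1 : (1 - (q : ℂ)) ≠ 0 := by
    rw [sub_ne_zero]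
    exact_mod_cast hq.ne'
  have hqC : ‖(q : ℂ)‖ < 1 := by rwa [Complex.norm_real, Real.norm_of_nonneg hq0]
  have hcol : ∀ j, HasSum
      (fun l => z ^ j * (j.factorial : ℂ)⁻¹ * ((l.choose j : ℂ) * (q : ℂ) ^ l))
      (z ^ j * (j.factorial : ℂ)⁻¹ * ((q : ℂ) ^ j / (1 - (q : ℂ)) ^ (j + 1))) := fun j =>
    (hasSum_choose_mul_pow j hqC).mul_left _
  have hcolN : ∀ j, HasSum
      (fun l => ‖z ^ j * (j.factorial : ℂ)⁻¹ * ((l.choose j : ℂ) * (q : ℂ) ^ l)‖)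
      (‖z‖ ^ j * (j.factorial : ℝ)⁻¹ * (q ^ j / (1 - q) ^ (j + 1))) := fun j => by
    refine hasSum_congr ((hasSum_choose_mul_pow j (q := q)
      (by rwa [Real.norm_of_nonneg hq0])).mul_left (‖z‖ ^ j * (j.factorial : ℝ)⁻¹))
      (fun l => ?_) rfl
    simp only [norm_mul, norm_pow, norm_inv, Complex.norm_natCast, Complex.norm_real,
      Real.norm_of_nonneg hq0]
  have hexp : HasSum
      (fun j : ℕ => z ^ j * (j.factorial : ℂ)⁻¹ * ((q : ℂ) ^ j / (1 - (q : ℂ)) ^ (j + 1)))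
      ((1 - (q : ℂ))⁻¹ * Complex.exp (z * q / (1 - q))) := by
    rw [Complex.exp_eq_exp_ℂ]
    refine hasSum_congr ((NormedSpace.exp_series_hasSum_exp' (𝕂 := ℂ)
      (z * q / (1 - q))).mul_left (1 - (q : ℂ))⁻¹) (fun j => ?_) rfl
    rw [smul_eq_mul, div_pow, mul_pow, pow_succ]
    field_simp
  have hs : Summable (Function.uncurry fun j l : ℕ =>
      z ^ j * (j.factorial : ℂ)⁻¹ * ((l.choose j : ℂ) * (q : ℂ) ^ l)) := by
    refine Summable.of_norm ?_
    rw [summable_prod_of_nonneg (fun p => norm_nonneg _)]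
    refine ⟨fun j => (hcolN j).summable, ?_⟩
    simp only [Function.uncurry, (hcolN _).tsum_eq]
    refine ((Real.summable_pow_div_factorial (‖z‖ * q / (1 - q))).mul_left (1 - q)⁻¹).congr
      fun j => ?_
    have : (1 - q) ≠ 0 := by linarith
    rw [div_pow, mul_pow, pow_succ]
    field_simp
  refine hasSum_congr (hasSum_triangular hs hcol hexp fun j l h => ?_) (fun l => ?_) rfl
  · rw [Nat.choose_eq_zero_of_lt h, Nat.cast_zero, zero_mul, mul_zero]
  · rw [Finset.mul_sum]
    exact Finset.sum_congr rfl fun j _ => by ring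

section

variable [CompleteSpace H]

open PowerSeries in
/-- The generating function of the matrix elements `⟨m|D(ξ)|n⟩`, for fixed `m`. -/
theorem dispElem_eq_coeff (b : HilbertBasis ℕ ℂ H) (ξ : ℂ) (m n : ℕ) :
    ((√(m.factorial : ℝ) : ℝ) : ℂ) * (((√(n.factorial : ℝ) : ℝ) : ℂ)⁻¹ * dispElem b ξ m n)
      = Complex.exp (-(ξ * conj ξ) / 2) * coeff n ((X + C ξ) ^ m
        * PowerSeries.mk fun j => (-conj ξ) ^ j * (j.factorial : ℂ)⁻¹) := by
  induction m generalizing n with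
  | zero =>
    have h : ((√(n.factorial : ℝ) : ℝ) : ℂ)⁻¹ * ((√(n.factorial : ℝ) : ℝ) : ℂ)⁻¹
        = (n.factorial : ℂ)⁻¹ := by
      rw [← mul_inv, ← Complex.ofReal_mul, Real.mul_self_sqrt (by positivity),
        Complex.ofReal_natCast]
    simp only [pow_zero, one_mul, coeff_mk, dispElem_zero_left, ← h, Nat.factorial_zero,
      Nat.cast_one, Real.sqrt_one, Complex.ofReal_one]
    ring
  | succ m ih =>
    have h := dispElem_annihilation b ξ m n
    have hm : ((√((m + 1).factorial : ℝ) : ℝ) : ℂ)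
        = ((√((m : ℝ) + 1) : ℝ) : ℂ) * ((√(m.factorial : ℝ) : ℝ) : ℂ) := by
      rw [Nat.factorial_succ, Nat.cast_mul, Real.sqrt_mul (by positivity), Nat.cast_succ,
        Complex.ofReal_mul]
    rw [pow_succ', mul_assoc, add_mul, map_add, coeff_C_mul, mul_add, mul_left_comm _ ξ, ← ih, hm]
    rcases n with _ | n
    · simp only [Nat.cast_zero, Real.sqrt_zero, Complex.ofReal_zero, zero_mul, zero_add] at h
      rw [coeff_zero_X_mul, mul_zero, zero_add]
      linear_combination ((√(m.factorial : ℝ) : ℝ) : ℂ)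
        * ((√((0 : ℕ).factorial : ℝ) : ℝ) : ℂ)⁻¹ * h
    · have hn := sqrt_succ_mul_coherentCoeff 1 n
      rw [one_pow, one_pow, one_mul, one_mul, one_mul] at hn
      rw [coeff_succ_X_mul, ← ih]
      rw [Nat.add_sub_cancel, Nat.cast_succ] at h
      linear_combination ((√(m.factorial : ℝ) : ℝ) : ℂ)
        * ((√((n + 1).factorial : ℝ) : ℝ) : ℂ)⁻¹ * h
        + ((√(m.factorial : ℝ) : ℝ) : ℂ) * dispElem b ξ m n * hn

open PowerSeries in
theorem dispElem_self (b : HilbertBasis ℕ ℂ H) (ξ : ℂ) (l : ℕ) :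
    dispElem b ξ l l = Complex.exp (-(ξ * conj ξ) / 2) * ∑ j ∈ Finset.range (l + 1),
      (l.choose j : ℂ) * ((-(ξ * conj ξ)) ^ j * (j.factorial : ℂ)⁻¹) := by
  have h := dispElem_eq_coeff b ξ l l
  have hl : ((√(l.factorial : ℝ) : ℝ) : ℂ) ≠ 0 := by
    rw [Complex.ofReal_ne_zero]; positivity
  rw [mul_inv_cancel_left₀ hl] at h
  rw [h, coeff_mul, ← Finset.Nat.sum_antidiagonal_swap,
    Finset.Nat.sum_antidiagonal_eq_sum_range_succ_mk]
  congr 1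
  refine Finset.sum_congr rfl fun j hj => ?_
  have hj' : j ≤ l := Nat.lt_succ_iff.1 (Finset.mem_range.1 hj)
  have hp : ((X + C ξ) ^ l : PowerSeries ℂ)
      = (((Polynomial.X + Polynomial.C ξ) ^ l : Polynomial ℂ) : PowerSeries ℂ) := by
    simp
  rw [Prod.swap, coeff_mk, hp, Polynomial.coeff_coe, Polynomial.coeff_X_add_C_pow,
    Nat.sub_sub_self hj', Nat.choose_symm hj', neg_pow (ξ * conj ξ), neg_pow (conj ξ), mul_pow]
  ring

/-- `∑ l, ⟨0|T_l† D(ξ) T_l|0⟩` is the characteristic function of a thermal state. -/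
theorem hasSum_krausConj_zero_zero (b : HilbertBasis ℕ ℂ H) {κ : ℝ} (hκ : 0 < κ) (ξ : ℂ) :
    HasSum (krausConj κ (dispElem b ξ) 0 0)
      (Complex.exp (-(1 + κ ^ 2) * (ξ * conj ξ) / 2 - κ ^ 2 * (ξ * conj ξ) / 2)) := by
  have hk : (0 : ℝ) < 1 + κ ^ 2 := by positivity
  have hk' : (1 + (κ : ℂ) ^ 2) ≠ 0 := by exact_mod_cast hk.ne'
  have hq : κ ^ 2 * (1 + κ ^ 2)⁻¹ < 1 := by
    rw [← div_eq_mul_inv, div_lt_one hk]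
    linarith
  have hq1 : 1 - ((κ ^ 2 * (1 + κ ^ 2)⁻¹ : ℝ) : ℂ) = (1 + (κ : ℂ) ^ 2)⁻¹ := by
    push_cast
    field_simp
    ring
  refine hasSum_congr ((hasSum_laguerre (-(ξ * conj ξ)) (by positivity) hq).mul_left
    (Complex.exp (-(ξ * conj ξ) / 2) * (1 + (κ : ℂ) ^ 2)⁻¹)) (fun l => ?_) ?_
  · have h := krausCoeff_sq hκ l 0
    rw [pow_zero, mul_one, Nat.choose_zero_right, Nat.cast_one, one_mul] at h
    have h' : (krausCoeff κ l 0 : ℂ) * krausCoeff κ l 0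
        = (1 + (κ : ℂ) ^ 2)⁻¹ * ((κ ^ 2 * (1 + κ ^ 2)⁻¹ : ℝ) : ℂ) ^ l := by
      rw [← sq]
      exact_mod_cast h
    rw [krausConj, h', Nat.sub_zero, dispElem_self]
    ring
  · rw [hq1, inv_inv, mul_assoc, inv_mul_cancel_left₀ hk', ← Complex.exp_add]
    congr 1
    push_cast
    field_simp
    ring

/-! ### The Heisenberg picture: `∑ l, T_l† D(ξ) T_l` -/

theorem inner_kraus_displacement_kraus_fock (b : HilbertBasis ℕ ℂ H) (κ : ℝ) (ξ : ℂ) (m n l : ℕ) :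
    ⟪kraus b κ l (b m), displacement b ξ (kraus b κ l (b n))⟫_ℂ
      = krausConj κ (dispElem b ξ) m n l := by
  rw [kraus_apply_fock, kraus_apply_fock, map_smul, inner_smul_left, inner_smul_right,
    Complex.conj_ofReal, ← mul_assoc, krausConj, dispElem]

theorem norm_inner_kraus_le (b : HilbertBasis ℕ ℂ H) (κ : ℝ) (ξ : ℂ) (x y : H) (l : ℕ) :
    ‖⟪kraus b κ l y, displacement b ξ (kraus b κ l x)⟫_ℂ‖
      ≤ ‖kraus b κ l y‖ * ‖kraus b κ l x‖ := by
  refine (norm_inner_le_norm _ _).trans ?_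
  rw [norm_displacement_apply]

theorem summable_inner_kraus (b : HilbertBasis ℕ ℂ H) {κ : ℝ} (hκ : 0 < κ) (ξ : ℂ) (x y : H) :
    Summable (fun l => ⟪kraus b κ l y, displacement b ξ (kraus b κ l x)⟫_ℂ) :=
  Summable.of_norm_bounded (summable_norm_kraus_mul_norm_kraus b hκ y x)
    (norm_inner_kraus_le b κ ξ x y)

/-- The scalar `exp (-(1+κ²)|ξ|²/2)` of the threshold noise. -/
def noise (κ : ℝ) (ξ : ℂ) : ℂ := Complex.exp (((-(1 + κ ^ 2) * ‖ξ‖ ^ 2 / 2 : ℝ) : ℂ))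

theorem hasSum_inner_kraus_fock (b : HilbertBasis ℕ ℂ H) {κ : ℝ} (hκ : 0 < κ) (ξ : ℂ) (m n : ℕ) :
    HasSum (fun l => ⟪kraus b κ l (b m), displacement b ξ (kraus b κ l (b n))⟫_ℂ)
      (noise κ ξ * ⟪b m, displacement b (-(κ : ℂ) * conj ξ) (b n)⟫_ℂ) := by
  simp only [inner_kraus_displacement_kraus_fock]
  have hs : ∀ m n, Summable (krausConj κ (dispElem b ξ) m n) := fun m n => by
    simpa only [inner_kraus_displacement_kraus_fock] using summable_inner_kraus b hκ ξ (b n) (b m)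
  set M : ℕ → ℕ → ℂ := fun m n => ∑' l, krausConj κ (dispElem b ξ) m n l with hM
  have hsum : ∀ m n, HasSum (krausConj κ (dispElem b ξ) m n) (M m n) := fun m n => (hs m n).hasSum
  have hnoise : noise κ ξ = Complex.exp (-(1 + κ ^ 2) * (ξ * conj ξ) / 2) := by
    rw [noise, Complex.mul_conj']
    push_cast
    rfl
  suffices h : ∀ m n, M m n - noise κ ξ * dispElem b (-(κ : ℂ) * conj ξ) m n = 0 by
    have h' := sub_eq_zero.1 (h m n)
    rw [← dispElem, ← h']
    exact hsum m n
  refine eq_zero_of_ladder_relations (η := -(κ : ℂ) * conj ξ) (ζ := conj (-(κ : ℂ) * conj ξ))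
    (fun m n => ?_) (fun m n => ?_) ?_
  -- The transposed array of matrix elements satisfies the ladder relation with `-ξ*` for `ξ`.
  · have h := krausConj_sum_ladder hκ (d := fun m n => dispElem b ξ n m) (ξ := -conj ξ)
      (fun m n => by linear_combination -dispElem_creation b ξ n m) (M := fun m n => M n m)
      (fun m n => by
        refine hasSum_congr (hsum n m) (fun l => ?_) rfl
        simp only [krausConj]
        ring) n m
    linear_combination -h - noise κ ξ * dispElem_annihilation b (-(κ : ℂ) * conj ξ) m n
  · have h := krausConj_sum_ladder hκ (dispElem_annihilation b ξ) hsum m n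
    have h2 := dispElem_creation b (-(κ : ℂ) * conj ξ) m n
    simp only [map_mul, map_neg, Complex.conj_ofReal, Complex.conj_conj] at h2 ⊢
    linear_combination h - noise κ ξ * h2
  · rw [(hsum 0 0).unique (hasSum_krausConj_zero_zero b hκ ξ), dispElem_zero_zero, hnoise,
      ← Complex.exp_add, sub_eq_zero]
    congr 1
    simp only [map_mul, map_neg, Complex.conj_ofReal, Complex.conj_conj]
    ring

/-- `∑ l, T_l† D(ξ) T_l = exp (-(1+κ²)|ξ|²/2) D(-κ ξ*)`, weakly. -/
theorem hasSum_inner_kraus (b : HilbertBasis ℕ ℂ H) {κ : ℝ} (hκ : 0 < κ) (ξ : ℂ) (x y : H) :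
    HasSum (fun l => ⟪kraus b κ l y, displacement b ξ (kraus b κ l x)⟫_ℂ)
      (noise κ ξ * ⟪y, displacement b (-(κ : ℂ) * conj ξ) x⟫_ℂ) := by
  have hs := summable_inner_kraus b hκ ξ
  let F : H →L⋆[ℂ] H →L[ℂ] ℂ := LinearMap.mkContinuous₂
    (LinearMap.mk₂'ₛₗ (starRingEnd ℂ) (RingHom.id ℂ)
      (fun y x => ∑' l, ⟪kraus b κ l y, displacement b ξ (kraus b κ l x)⟫_ℂ)
      (fun y y' x => by
        simp only [map_add, inner_add_left]
        exact (hs x y).tsum_add (hs x y'))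
      (fun c y x => by
        simp only [map_smul, inner_smul_left]
        exact tsum_mul_left)
      (fun y x x' => by
        simp only [map_add, inner_add_right]
        exact (hs x y).tsum_add (hs x' y))
      (fun c y x => by
        simp only [map_smul, inner_smul_right]
        exact tsum_mul_left)) 1 (fun y x => by
      rw [one_mul]
      refine (tsum_of_norm_bounded (summable_norm_kraus_mul_norm_kraus b hκ y x).hasSum
        (norm_inner_kraus_le b κ ξ x y)).trans ?_
      exact tsum_norm_kraus_mul_norm_kraus_le b hκ y x)
  let G : H →L⋆[ℂ] H →L[ℂ] ℂ := LinearMap.mkContinuous₂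
    (LinearMap.mk₂'ₛₗ (starRingEnd ℂ) (RingHom.id ℂ)
      (fun y x => noise κ ξ * ⟪y, displacement b (-(κ : ℂ) * conj ξ) x⟫_ℂ)
      (fun y y' x => by rw [inner_add_left, mul_add])
      (fun c y x => by rw [inner_smul_left, smul_eq_mul, mul_left_comm])
      (fun y x x' => by rw [map_add, inner_add_right, mul_add])
      (fun c y x => by
        rw [map_smul, inner_smul_right, mul_left_comm]; rfl)) ‖noise κ ξ‖ (fun y x => by
      refine (norm_mul _ _).trans_le ?_
      rw [mul_assoc]
      refine mul_le_mul_of_nonneg_left ((norm_inner_le_norm _ _).trans ?_) (norm_nonneg _)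
      rw [norm_displacement_apply])
  have hFG : F = G := by
    refine sesqForm_ext (dense_span_fock b) ?_
    rintro _ ⟨m, rfl⟩ _ ⟨n, rfl⟩
    exact (hasSum_inner_kraus_fock b hκ ξ m n).tsum_eq
  exact (hs x y).hasSum_iff.2 (DFunLike.congr_fun (DFunLike.congr_fun hFG y) x)

end

/-! ### Traces of nuclear operators -/

theorem summable_norm_inner_mul (b : HilbertBasis ℕ ℂ H) (x y : H) :
    Summable (fun n => ‖⟪b n, y⟫_ℂ‖ * ‖⟪b n, x⟫_ℂ‖) :=
  summable_mul_of_hasSum_sq (hasSum_norm_sq_inner b y) (hasSum_norm_sq_inner b x)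
    (fun _ => norm_nonneg _) (fun _ => norm_nonneg _)

theorem tsum_norm_inner_mul_le (b : HilbertBasis ℕ ℂ H) (x y : H) :
    ∑' n, ‖⟪b n, y⟫_ℂ‖ * ‖⟪b n, x⟫_ℂ‖ ≤ ‖y‖ * ‖x‖ :=
  tsum_mul_le_of_hasSum_sq (hasSum_norm_sq_inner b y) (hasSum_norm_sq_inner b x)
    (fun _ => norm_nonneg _) (fun _ => norm_nonneg _) (norm_nonneg _) (norm_nonneg _)

theorem IsDyadSum.exists_hasSum_trace (b : HilbertBasis ℕ ℂ H) {x y : ℕ → H} {T : H →L[ℂ] H}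
    (hT : IsDyadSum x y T) (hs : Summable (fun i => ‖x i‖ * ‖y i‖)) :
    ∃ τ : ℂ, HasSum (fun n => ⟪b n, T (b n)⟫_ℂ) τ ∧ HasSum (fun i => ⟪y i, x i⟫_ℂ) τ := by
  set f : ℕ × ℕ → ℂ := fun p => ⟪y p.1, b p.2⟫_ℂ * ⟪b p.2, x p.1⟫_ℂ with hf
  have hnorm : ∀ i n, ‖f (i, n)‖ = ‖⟪b n, y i⟫_ℂ‖ * ‖⟪b n, x i⟫_ℂ‖ := fun i n => by
    simp only [hf, norm_mul]
    rw [norm_inner_symm]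
  have hsum : Summable f := by
    refine Summable.of_norm ?_
    rw [summable_prod_of_nonneg (fun p => norm_nonneg _)]
    simp only [hnorm]
    refine ⟨fun i => summable_norm_inner_mul b (x i) (y i), ?_⟩
    refine Summable.of_nonneg_of_le (fun i => tsum_nonneg fun n => by positivity)
      (fun i => ?_) hs
    rw [mul_comm ‖x i‖]
    exact tsum_norm_inner_mul_le b (x i) (y i)
  have hrow : HasSum (fun i => ⟪y i, x i⟫_ℂ) (∑' p, f p) :=
    hsum.hasSum.prod_fiberwise fun i => b.hasSum_inner_mul_inner (y i) (x i)
  have hswap : HasSum (f ∘ Equiv.prodComm ℕ ℕ) (∑' p, f p) := by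
    rw [Equiv.hasSum_iff]
    exact hsum.hasSum
  have hcol : HasSum (fun n => ⟪b n, T (b n)⟫_ℂ) (∑' p, f p) := by
    refine hswap.prod_fiberwise fun n => ?_
    refine hasSum_congr ((hT (b n)).mapL (innerSL ℂ (b n))) (fun i => ?_) rfl
    simp [hf]
  exact ⟨_, hcol, hrow⟩

/-- `Tr (∑ i, |x i⟩⟨y i|) = ∑ i, ⟨y i|x i⟩`. -/
theorem IsDyadSum.hasSum_trace (b : HilbertBasis ℕ ℂ H) {x y : ℕ → H} {T : H →L[ℂ] H}
    (hT : IsDyadSum x y T) (hs : Summable (fun i => ‖x i‖ * ‖y i‖)) :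
    HasSum (fun i => ⟪y i, x i⟫_ℂ) (trace b T) := by
  obtain ⟨τ, h1, h2⟩ := hT.exists_hasSum_trace b hs
  rwa [trace, h1.tsum_eq]

theorem IsDyadSum.comp_left {x y : ℕ → H} {T : H →L[ℂ] H} (hT : IsDyadSum x y T)
    (A : H →L[ℂ] H) : IsDyadSum (fun i => A (x i)) y (A ∘L T) := fun v => by
  refine hasSum_congr ((hT v).mapL A) (fun i => ?_) rfl
  rw [map_smul]

section

variable [CompleteSpace H]

theorem hasSum_weylChar (b : HilbertBasis ℕ ℂ H) {x y : ℕ → H} {ρ : TraceClass H}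
    (hρ : IsDyadSum x y (ρ : H →L[ℂ] H)) (hs : Summable (fun i => ‖x i‖ * ‖y i‖)) (ξ : ℂ) :
    HasSum (fun i => ⟪y i, displacement b ξ (x i)⟫_ℂ) (weylChar b ρ ξ) :=
  (hρ.comp_left (displacement b ξ)).hasSum_trace b
    (by simpa only [norm_displacement_apply] using hs)

theorem weylChar_sub (b : HilbertBasis ℕ ℂ H) (ρ σ : TraceClass H) (ξ : ℂ) :
    weylChar b (ρ - σ) ξ = weylChar b ρ ξ - weylChar b σ ξ := by
  have h : ∀ τ : TraceClass H,
      Summable (fun n => ⟪b n, (displacement b ξ ∘L (τ : H →L[ℂ] H)) (b n)⟫_ℂ) := by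
    intro τ
    obtain ⟨x, y, hs, hd⟩ := τ.2
    obtain ⟨t, ht, -⟩ := (hd.comp_left (displacement b ξ)).exists_hasSum_trace b
      (by simpa only [norm_displacement_apply] using hs)
    exact ht.summable
  simp only [weylChar, trace]
  rw [← (h ρ).tsum_sub (h σ)]
  refine tsum_congr fun n => ?_
  simp

/-! ### A Gaussian integral of displacement operators -/

open MeasureTheory

/-- A Gaussian on the complex plane factors into its real and imaginary directions. -/
theorem gaussian_eq_mul (r : ℝ) (p q : ℂ) (z : ℂ) :
    Complex.exp (-r * (z * conj z) + p * z + q * conj z)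
      = Complex.exp (-r * (z.re : ℂ) ^ 2 + (p + q) * z.re + 0)
        * Complex.exp (-r * (z.im : ℂ) ^ 2 + (Complex.I * (p - q)) * z.im + 0) := by
  rw [← Complex.exp_add]
  congr 1
  have h1 : z = z.re + z.im * Complex.I := (Complex.re_add_im z).symm
  have h2 : conj z = z.re - z.im * Complex.I := by
    rw [← Complex.re_add_im (conj z)]
    simp [sub_eq_add_neg]
  have h3 : z * conj z = (z.re : ℂ) ^ 2 + (z.im : ℂ) ^ 2 := by
    rw [Complex.mul_conj, Complex.normSq_apply]
    push_cast
    ring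
  linear_combination -r * h3 + p * h1 + q * h2

theorem integrable_gaussian {r : ℝ} (hr : 0 < r) (p q : ℂ) :
    Integrable (fun z : ℂ => Complex.exp (-r * (z * conj z) + p * z + q * conj z)) := by
  have hre : (-r : ℂ).re < 0 := by simpa using hr
  have h := (integrable_cexp_quadratic' hre (p + q) 0).mul_prod
    (integrable_cexp_quadratic' hre (Complex.I * (p - q)) 0)
  simp only [gaussian_eq_mul]
  exact (Complex.volume_preserving_equiv_real_prod.integrable_comp_emb
    Complex.measurableEquivRealProd.measurableEmbedding).2 h

theorem integral_gaussian_complex (p q : ℂ) :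
    ∫ z : ℂ, Complex.exp (-(z * conj z) + p * z + q * conj z) = Real.pi * Complex.exp (p * q) := by
  have hre : (-(1 : ℝ) : ℂ).re < 0 := by simp
  have h := Complex.volume_preserving_equiv_real_prod.integral_comp
    Complex.measurableEquivRealProd.measurableEmbedding (fun w : ℝ × ℝ =>
      Complex.exp (-(1 : ℝ) * (w.1 : ℂ) ^ 2 + (p + q) * w.1 + 0)
        * Complex.exp (-(1 : ℝ) * (w.2 : ℂ) ^ 2 + (Complex.I * (p - q)) * w.2 + 0))
  have hg : ∀ z : ℂ, Complex.exp (-(z * conj z) + p * z + q * conj z)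
      = Complex.exp (-(1 : ℝ) * (z.re : ℂ) ^ 2 + (p + q) * z.re + 0)
        * Complex.exp (-(1 : ℝ) * (z.im : ℂ) ^ 2 + (Complex.I * (p - q)) * z.im + 0) := fun z => by
    rw [← gaussian_eq_mul, Complex.ofReal_one, neg_one_mul]
  simp only [hg]
  refine Eq.trans h ?_
  have hpi : ((Real.pi : ℂ) / -(-(1 : ℝ))) ^ (1 / 2 : ℂ)
      * ((Real.pi : ℂ) / -(-(1 : ℝ))) ^ (1 / 2 : ℂ) = Real.pi := by
    rw [neg_neg, Complex.ofReal_one, div_one,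
      ← Complex.cpow_add _ _ (Complex.ofReal_ne_zero.2 Real.pi_pos.ne')]
    norm_num
  rw [Measure.volume_eq_prod, integral_prod_mul
    (fun u : ℝ => Complex.exp (-(1 : ℝ) * (u : ℂ) ^ 2 + (p + q) * u + 0))
    (fun v : ℝ => Complex.exp (-(1 : ℝ) * (v : ℂ) ^ 2 + (Complex.I * (p - q)) * v + 0)),
    integral_cexp_quadratic hre, integral_cexp_quadratic hre, mul_mul_mul_comm, hpi,
    ← Complex.exp_add]
  congr 2
  push_cast
  linear_combination (p - q) ^ 2 / 4 * Complex.I_sq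

theorem norm_inner_displacement_le (b : HilbertBasis ℕ ℂ H) (ξ : ℂ) (x y : H) :
    ‖⟪y, displacement b ξ x⟫_ℂ‖ ≤ ‖y‖ * ‖x‖ := by
  refine (norm_inner_le_norm _ _).trans ?_
  rw [norm_displacement_apply]

theorem continuous_inner_displacement (b : HilbertBasis ℕ ℂ H) (x y : H) :
    Continuous fun ξ => ⟪y, displacement b ξ x⟫_ℂ := by
  have h1 : ∀ β x, Continuous fun ξ => ⟪coherent b β, displacement b ξ x⟫_ℂ := fun β x => by
    refine continuous_apply_of_dense (dense_span_coherent b)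
      (f := fun ξ => (innerSL ℂ (coherent b β)).comp (displacement b ξ)) (c := ‖coherent b β‖)
      (fun ξ v => norm_inner_displacement_le b ξ v _) ?_ x
    rintro _ ⟨α, rfl⟩
    simp only [ContinuousLinearMap.comp_apply, innerSL_apply_apply,
      inner_coherent_displacement_coherent]
    fun_prop
  have h2 : Continuous fun ξ => ⟪displacement b ξ x, y⟫_ℂ := by
    refine continuous_apply_of_dense (dense_span_coherent b)
      (f := fun ξ => innerSL ℂ (displacement b ξ x)) (c := ‖x‖) (fun ξ v => ?_) ?_ y
    · refine (norm_inner_le_norm _ _).trans ?_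
      rw [norm_displacement_apply]
    · rintro _ ⟨β, rfl⟩
      simp only [innerSL_apply_apply]
      refine (Complex.continuous_conj.comp (h1 β x)).congr fun ξ => ?_
      exact inner_conj_symm _ _
  refine (Complex.continuous_conj.comp h2).congr fun ξ => ?_
  exact inner_conj_symm _ _

/-- The Gaussian `⟨e_α, D(-ξ) e_β⟩`. -/
def coherentKernel (α β ξ : ℂ) : ℂ :=
  Complex.exp (-(ξ * conj ξ) / 2 + conj ξ * β + conj α * (β - ξ))

theorem integrable_coherentKernel (α β : ℂ) : Integrable (coherentKernel α β) := by
  have h := (integrable_gaussian (r := 1 / 2) (by norm_num) (-conj α) β).const_mul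
    (Complex.exp (conj α * β))
  refine h.congr (Eventually.of_forall fun ξ => ?_)
  simp only [coherentKernel]
  rw [← Complex.exp_add]
  congr 1
  push_cast
  ring

theorem integrable_coherentKernel_mul (b : HilbertBasis ℕ ℂ H) (α β : ℂ) (x y : H) :
    Integrable (fun ξ => coherentKernel α β ξ * ⟪y, displacement b ξ x⟫_ℂ) :=
  (integrable_coherentKernel α β).mul_bdd (c := ‖y‖ * ‖x‖)
    (continuous_inner_displacement b x y).aestronglyMeasurable
    (Eventually.of_forall fun ξ => norm_inner_displacement_le b ξ x y)

theorem integral_norm_coherentKernel_mul_le (b : HilbertBasis ℕ ℂ H) (α β : ℂ) (x y : H) :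
    ∫ ξ, ‖coherentKernel α β ξ * ⟪y, displacement b ξ x⟫_ℂ‖
      ≤ (∫ ξ, ‖coherentKernel α β ξ‖) * ‖y‖ * ‖x‖ := by
  rw [mul_assoc, ← integral_mul_const]
  refine integral_mono (integrable_coherentKernel_mul b α β x y).norm
    ((integrable_coherentKernel α β).norm.mul_const _) fun ξ => ?_
  simp only [norm_mul]
  exact mul_le_mul_of_nonneg_left (norm_inner_displacement_le b ξ x y) (norm_nonneg _)

/-- The rank one operator `|e_β⟩⟨e_α|` is a Gaussian superposition of displacement operators:
`π |e_β⟩⟨e_α| = ∫ ⟨e_α, D(-ξ) e_β⟩ D(ξ) dξ`, weakly. -/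
theorem integral_coherentKernel_mul (b : HilbertBasis ℕ ℂ H) (α β : ℂ) (x y : H) :
    ∫ ξ, coherentKernel α β ξ * ⟪y, displacement b ξ x⟫_ℂ
      = Real.pi * (⟪y, coherent b β⟫_ℂ * ⟪coherent b α, x⟫_ℂ) := by
  have hi := integrable_coherentKernel_mul b α β
  let F : H →L⋆[ℂ] H →L[ℂ] ℂ := LinearMap.mkContinuous₂
    (LinearMap.mk₂'ₛₗ (starRingEnd ℂ) (RingHom.id ℂ)
      (fun y x => ∫ ξ, coherentKernel α β ξ * ⟪y, displacement b ξ x⟫_ℂ)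
      (fun y y' x => by
        simp only [inner_add_left, mul_add]
        exact integral_add (hi x y) (hi x y'))
      (fun c y x => by
        simp only [inner_smul_left, mul_left_comm _ (conj c)]
        exact integral_const_mul _ _)
      (fun y x x' => by
        simp only [map_add, inner_add_right, mul_add]
        exact integral_add (hi x y) (hi x' y))
      (fun c y x => by
        simp only [map_smul, inner_smul_right, mul_left_comm _ c]
        exact integral_const_mul _ _)) (∫ ξ, ‖coherentKernel α β ξ‖) (fun y x =>
      (norm_integral_le_integral_norm _).trans (integral_norm_coherentKernel_mul_le b α β x y))
  let G : H →L⋆[ℂ] H →L[ℂ] ℂ := LinearMap.mkContinuous₂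
    (LinearMap.mk₂'ₛₗ (starRingEnd ℂ) (RingHom.id ℂ)
      (fun y x => (Real.pi : ℂ) * (⟪y, coherent b β⟫_ℂ * ⟪coherent b α, x⟫_ℂ))
      (fun y y' x => by rw [inner_add_left]; ring)
      (fun c y x => by rw [inner_smul_left, smul_eq_mul]; ring)
      (fun y x x' => by rw [inner_add_right]; ring)
      (fun c y x => by rw [inner_smul_right, RingHom.id_apply, smul_eq_mul]; ring))
      (Real.pi * (‖coherent b β‖ * ‖coherent b α‖)) (fun y x => by
        refine (norm_mul _ _).trans_le ?_
        rw [Complex.norm_real, Real.norm_of_nonneg Real.pi_pos.le, norm_mul, mul_assoc, mul_assoc]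
        refine mul_le_mul_of_nonneg_left ?_ Real.pi_pos.le
        calc _ ≤ (‖y‖ * ‖coherent b β‖) * (‖coherent b α‖ * ‖x‖) :=
              mul_le_mul (norm_inner_le_norm _ _) (norm_inner_le_norm _ _) (norm_nonneg _)
                (by positivity)
          _ = _ := by ring)
  have hFG : F = G := by
    refine sesqForm_ext (dense_span_coherent b) ?_
    rintro _ ⟨δ, rfl⟩ _ ⟨γ, rfl⟩
    change ∫ ξ, coherentKernel α β ξ * ⟪coherent b δ, displacement b ξ (coherent b γ)⟫_ℂ
      = Real.pi * (⟪coherent b δ, coherent b β⟫_ℂ * ⟪coherent b α, coherent b γ⟫_ℂ)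
    have hpt : ∀ ξ, coherentKernel α β ξ * ⟪coherent b δ, displacement b ξ (coherent b γ)⟫_ℂ
        = Complex.exp (conj α * β + conj δ * γ) * Complex.exp (-(ξ * conj ξ)
          + (conj δ - conj α) * ξ + (β - γ) * conj ξ) := fun ξ => by
      rw [inner_coherent_displacement_coherent, coherentKernel, ← Complex.exp_add,
        ← Complex.exp_add]
      congr 1
      ring
    simp only [hpt]
    rw [integral_const_mul, integral_gaussian_complex, mul_left_comm, inner_coherent_coherent,
      inner_coherent_coherent, ← Complex.exp_add, ← Complex.exp_add]
    congr 2
    ring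
  exact DFunLike.congr_fun (DFunLike.congr_fun hFG y) x

/-- A trace-class operator is determined by its characteristic function: if `Tr (D(ξ) σ) = 0` for
all `ξ`, integrating against a Gaussian gives `⟨e_α, σ e_β⟩ = 0` for all coherent vectors. -/
theorem eq_zero_of_weylChar_eq_zero (b : HilbertBasis ℕ ℂ H) {σ : TraceClass H}
    (h : ∀ ξ, weylChar b σ ξ = 0) : σ = 0 := by
  obtain ⟨x, y, hs, hd⟩ := σ.2
  have hcoh : ∀ α β, ⟪coherent b α, (σ : H →L[ℂ] H) (coherent b β)⟫_ℂ = 0 := by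
    intro α β
    have h1 := hasSum_integral_of_summable_integral_norm
      (fun i => integrable_coherentKernel_mul b α β (x i) (y i))
      (Summable.of_nonneg_of_le (fun i => integral_nonneg fun ξ => norm_nonneg _)
        (fun i => integral_norm_coherentKernel_mul_le b α β (x i) (y i))
        (by simpa only [mul_assoc, mul_comm ‖y _‖] using hs.mul_left (∫ ξ, ‖coherentKernel α β ξ‖)))
    have h2 : ∀ ξ, ∑' i, coherentKernel α β ξ * ⟪y i, displacement b ξ (x i)⟫_ℂ = 0 := fun ξ => by
      rw [tsum_mul_left, (hasSum_weylChar b hd hs ξ).tsum_eq, h, mul_zero]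
    simp only [h2, integral_zero, integral_coherentKernel_mul] at h1
    have h3 := ((hd (coherent b β)).mapL (innerSL ℂ (coherent b α))).mul_left (Real.pi : ℂ)
    have h4 := h3.unique (hasSum_congr h1 (fun i => by simp) rfl)
    exact (mul_eq_zero.1 h4).resolve_left (Complex.ofReal_ne_zero.2 Real.pi_pos.ne')
  refine Subtype.ext (ContinuousLinearMap.ext_on (dense_span_coherent b) ?_)
  rintro _ ⟨β, rfl⟩
  exact eq_zero_of_inner_coherent b fun α => hcoh α β

end

/-! ### The channel -/

/-- The operator norm is bounded by the trace norm. -/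
theorem IsDyadSum.norm_le {x y : ℕ → H} {T : H →L[ℂ] H} (hT : IsDyadSum x y T)
    (hs : Summable (fun i => ‖x i‖ * ‖y i‖)) : ‖T‖ ≤ ∑' i, ‖x i‖ * ‖y i‖ := by
  refine T.opNorm_le_bound (tsum_nonneg fun i => by positivity) fun v => ?_
  rw [← (hT v).tsum_eq]
  refine tsum_of_norm_bounded (hs.hasSum.mul_right ‖v‖) fun i => ?_
  rw [norm_smul, mul_comm, mul_assoc]
  exact mul_le_mul_of_nonneg_left (norm_inner_le_norm _ _) (norm_nonneg _)

theorem summable_norm_kraus_prod (b : HilbertBasis ℕ ℂ H) {κ : ℝ} (hκ : 0 < κ) {x y : ℕ → H}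
    (hs : Summable (fun i => ‖x i‖ * ‖y i‖)) : Summable (fun p : ℕ × ℕ =>
      ‖kraus b κ p.2 (x p.1)‖ * ‖kraus b κ p.2 (y p.1)‖) := by
  rw [summable_prod_of_nonneg (fun p => by positivity)]
  refine ⟨fun i => summable_norm_kraus_mul_norm_kraus b hκ (x i) (y i), ?_⟩
  exact Summable.of_nonneg_of_le (fun i => tsum_nonneg fun l => by positivity)
    (fun i => tsum_norm_kraus_mul_norm_kraus_le b hκ (x i) (y i)) hs

theorem traceNorm_le {x y : ℕ → H} {T : H →L[ℂ] H} (hT : IsDyadSum x y T) :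
    traceNorm T ≤ ∑' i, ‖x i‖ₑ * ‖y i‖ₑ :=
  iInf_le_of_le x (iInf_le_of_le y (iInf_le _ hT))

section

variable [CompleteSpace H]

/-- The operator `T_l(κ) ρ T_l(κ)†`. -/
def krausTerm (b : HilbertBasis ℕ ℂ H) (κ : ℝ) (ρ : H →L[ℂ] H) (l : ℕ) : H →L[ℂ] H :=
  kraus b κ l ∘L ρ ∘L ContinuousLinearMap.adjoint (kraus b κ l)

theorem IsDyadSum.krausTerm {b : HilbertBasis ℕ ℂ H} {x y : ℕ → H} {ρ : H →L[ℂ] H}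
    (hρ : IsDyadSum x y ρ) (κ : ℝ) (l : ℕ) :
    IsDyadSum (fun i => kraus b κ l (x i)) (fun i => kraus b κ l (y i)) (krausTerm b κ ρ l) :=
  fun v => by
    refine hasSum_congr ((hρ (ContinuousLinearMap.adjoint (kraus b κ l) v)).mapL (kraus b κ l))
      (fun i => ?_) rfl
    rw [map_smul, ContinuousLinearMap.adjoint_inner_right]

theorem summable_krausTerm (b : HilbertBasis ℕ ℂ H) {κ : ℝ} (hκ : 0 < κ) {ρ : H →L[ℂ] H}
    (hρ : IsTraceClass ρ) : Summable (krausTerm b κ ρ) := by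
  obtain ⟨x, y, hs, hd⟩ := hρ
  have h := (summable_norm_kraus_prod b hκ hs).prod_symm
  exact Summable.of_norm_bounded h.prod fun l => (hd.krausTerm κ l).norm_le (h.prod_factor l)

/-- The series `∑ l, T_l(κ) ρ T_l(κ)†`, which converges in operator norm for trace-class `ρ`. -/
def krausSum (b : HilbertBasis ℕ ℂ H) (κ : ℝ) (ρ : H →L[ℂ] H) : H →L[ℂ] H :=
  ∑' l, krausTerm b κ ρ l

theorem hasSum_krausTerm_apply (b : HilbertBasis ℕ ℂ H) {κ : ℝ} (hκ : 0 < κ) {ρ : H →L[ℂ] H}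
    (hρ : IsTraceClass ρ) (v : H) : HasSum (fun l => krausTerm b κ ρ l v) (krausSum b κ ρ v) :=
  (summable_krausTerm b hκ hρ).hasSum.mapL (ContinuousLinearMap.apply ℂ H v)

/-- The dyad `|T_l x i⟩⟨T_l y i|`, indexed by `(i, l) = e n`, is dropped for `l ∈ s`. This leaves
an expansion of the tail of the Kraus series. -/
theorem isDyadSum_krausSum_sub (b : HilbertBasis ℕ ℂ H) {κ : ℝ} (hκ : 0 < κ) {x y : ℕ → H}
    {ρ : H →L[ℂ] H} (hd : IsDyadSum x y ρ) (hs : Summable (fun i => ‖x i‖ * ‖y i‖))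
    (s : Finset ℕ) (e : ℕ ≃ ℕ × ℕ) :
    IsDyadSum (fun n => if (e n).2 ∈ s then 0 else kraus b κ (e n).2 (x (e n).1))
      (fun n => kraus b κ (e n).2 (y (e n).1))
      (krausSum b κ ρ - ∑ l ∈ s, krausTerm b κ ρ l) := by
  intro v
  set f : ℕ × ℕ → H := fun p => ⟪kraus b κ p.2 (y p.1), v⟫_ℂ •
    (if p.2 ∈ s then 0 else kraus b κ p.2 (x p.1)) with hf
  have hsum : Summable f := by
    refine Summable.of_norm_bounded ((summable_norm_kraus_prod b hκ hs).mul_right ‖v‖) fun p => ?_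
    have h1 : ‖(if p.2 ∈ s then 0 else kraus b κ p.2 (x p.1) : H)‖ ≤ ‖kraus b κ p.2 (x p.1)‖ := by
      split_ifs
      · simp
      · exact le_rfl
    rw [hf, norm_smul, mul_comm, mul_assoc]
    exact mul_le_mul h1 (norm_inner_le_norm _ _) (norm_nonneg _) (norm_nonneg _)
  have hswap : HasSum (f ∘ Equiv.prodComm ℕ ℕ) (∑' p, f p) := by
    rw [Equiv.hasSum_iff]
    exact hsum.hasSum
  have hrow : HasSum (fun l => if l ∈ s then 0 else krausTerm b κ ρ l v) (∑' p, f p) := by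
    refine hswap.prod_fiberwise fun l => ?_
    by_cases hl : l ∈ s
    · refine hasSum_congr (hasSum_zero : HasSum (fun _ : ℕ => (0 : H)) 0) (fun i => ?_) (if_pos hl)
      simp [hf, hl]
    · refine hasSum_congr (hd.krausTerm κ l v) (fun i => ?_) (if_neg hl)
      simp [hf, hl]
  have htail : HasSum (fun l => if l ∈ s then 0 else krausTerm b κ ρ l v)
      ((krausSum b κ ρ - ∑ l ∈ s, krausTerm b κ ρ l) v) := by
    have h1 : HasSum (fun l => if l ∈ s then krausTerm b κ ρ l v else 0)
        (∑ l ∈ s, if l ∈ s then krausTerm b κ ρ l v else 0) :=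
      hasSum_sum_of_ne_finset_zero fun l hl => if_neg hl
    refine hasSum_congr ((hasSum_krausTerm_apply b hκ ⟨x, y, hs, hd⟩ v).sub h1) (fun l => ?_) ?_
    · split_ifs <;> simp
    · rw [sub_apply, sum_apply]
      congr 1
      exact Finset.sum_congr rfl fun l hl => (if_pos hl).symm
  have hre : HasSum (f ∘ e) (∑' p, f p) := e.hasSum_iff.2 hsum.hasSum
  exact hasSum_congr hre (fun n => rfl) (htail.unique hrow)

theorem isDyadSum_krausSum (b : HilbertBasis ℕ ℂ H) {κ : ℝ} (hκ : 0 < κ) {x y : ℕ → H}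
    {ρ : H →L[ℂ] H} (hd : IsDyadSum x y ρ) (hs : Summable (fun i => ‖x i‖ * ‖y i‖))
    (e : ℕ ≃ ℕ × ℕ) :
    IsDyadSum (fun n => kraus b κ (e n).2 (x (e n).1)) (fun n => kraus b κ (e n).2 (y (e n).1))
      (krausSum b κ ρ) := by
  simpa using isDyadSum_krausSum_sub b hκ hd hs ∅ e

theorem isTraceClass_krausSum (b : HilbertBasis ℕ ℂ H) {κ : ℝ} (hκ : 0 < κ) {ρ : H →L[ℂ] H}
    (hρ : IsTraceClass ρ) : IsTraceClass (krausSum b κ ρ) := by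
  obtain ⟨x, y, hs, hd⟩ := hρ
  obtain ⟨e⟩ : Nonempty (ℕ ≃ ℕ × ℕ) := ⟨Nat.pairEquiv.symm⟩
  exact ⟨_, _, e.summable_iff.2 (summable_norm_kraus_prod b hκ hs),
    isDyadSum_krausSum b hκ hd hs e⟩

/-- The phase conjugation channel `ρ ↦ ∑ l, T_l(κ) ρ T_l(κ)†` on trace-class operators. -/
def channel (b : HilbertBasis ℕ ℂ H) {κ : ℝ} (hκ : 0 < κ) : TraceClass H →ₗ[ℂ] TraceClass H where
  toFun ρ := ⟨krausSum b κ ρ, isTraceClass_krausSum b hκ ρ.2⟩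
  map_add' ρ σ := by
    refine Subtype.ext ?_
    change ∑' l, krausTerm b κ ((ρ : H →L[ℂ] H) + (σ : H →L[ℂ] H)) l
      = ∑' l, krausTerm b κ ρ l + ∑' l, krausTerm b κ σ l
    rw [← (summable_krausTerm b hκ ρ.2).tsum_add (summable_krausTerm b hκ σ.2)]
    refine tsum_congr fun l => ?_
    rw [krausTerm, ContinuousLinearMap.add_comp, ContinuousLinearMap.comp_add]
    rfl
  map_smul' c ρ := by
    refine Subtype.ext ?_
    change ∑' l, krausTerm b κ (c • (ρ : H →L[ℂ] H)) l = c • ∑' l, krausTerm b κ ρ l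
    rw [← (summable_krausTerm b hκ ρ.2).tsum_const_smul]
    refine tsum_congr fun l => ?_
    rw [krausTerm, ContinuousLinearMap.smul_comp, ContinuousLinearMap.comp_smul]
    rfl

theorem weylChar_channel (b : HilbertBasis ℕ ℂ H) {κ : ℝ} (hκ : 0 < κ) (ρ : TraceClass H) :
    weylChar b (channel b hκ ρ) = phaseConj κ (weylChar b ρ) := by
  funext ξ
  obtain ⟨x, y, hs, hd⟩ := ρ.2
  obtain ⟨e⟩ : Nonempty (ℕ ≃ ℕ × ℕ) := ⟨Nat.pairEquiv.symm⟩
  have h1 := hasSum_weylChar b (ρ := channel b hκ ρ) (isDyadSum_krausSum b hκ hd hs e)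
    (e.summable_iff.2 (summable_norm_kraus_prod b hκ hs)) ξ
  have h2 : HasSum (fun p : ℕ × ℕ =>
      ⟪kraus b κ p.2 (y p.1), displacement b ξ (kraus b κ p.2 (x p.1))⟫_ℂ)
      (weylChar b (channel b hκ ρ) ξ) := e.hasSum_iff.1 h1
  have h3 := h2.prod_fiberwise fun i => hasSum_inner_kraus b hκ ξ (x i) (y i)
  rw [h3.unique ((hasSum_weylChar b hd hs _).mul_left (noise κ ξ)), mul_comm]
  rfl

theorem isCompletelyPositive_channel (b : HilbertBasis ℕ ℂ H) {κ : ℝ} (hκ : 0 < κ) :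
    IsCompletelyPositive (channel b hκ) := by
  intro k R hR x
  have h : HasSum (fun l => ∑ i, ∑ j, ⟪x i, krausTerm b κ (R i j : H →L[ℂ] H) l (x j)⟫_ℂ)
      (∑ i, ∑ j, ⟪x i, (channel b hκ (R i j) : H →L[ℂ] H) (x j)⟫_ℂ) :=
    hasSum_sum fun i _ => hasSum_sum fun j _ =>
      (hasSum_krausTerm_apply b hκ (R i j).2 (x j)).mapL (innerSL ℂ (x i))
  refine h.nonneg fun l => ?_
  refine (hR fun i => ContinuousLinearMap.adjoint (kraus b κ l) (x i)).trans_eq ?_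
  refine Finset.sum_congr rfl fun i _ => Finset.sum_congr rfl fun j _ => ?_
  rw [ContinuousLinearMap.adjoint_inner_left]
  rfl

/-- The Kraus series converges unconditionally in trace norm: the expansion of the tail outside `s`
bounds its trace norm by the tail of a convergent series. -/
theorem tendsto_traceNorm_krausSum_sub (b : HilbertBasis ℕ ℂ H) {κ : ℝ} (hκ : 0 < κ)
    {ρ : H →L[ℂ] H} (hρ : IsTraceClass ρ) :
    Tendsto (fun s : Finset ℕ => traceNorm (krausSum b κ ρ - ∑ l ∈ s, krausTerm b κ ρ l))
      atTop (𝓝 0) := by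
  obtain ⟨x, y, hs, hd⟩ := hρ
  obtain ⟨e⟩ : Nonempty (ℕ ≃ ℕ × ℕ) := ⟨Nat.pairEquiv.symm⟩
  set g : ℕ → ℝ≥0∞ := fun l => ∑' i, ‖kraus b κ l (x i)‖ₑ * ‖kraus b κ l (y i)‖ₑ with hg
  have hfin : ∑' l, g l ≠ ∞ := by
    have h1 : ∀ p : ℕ × ℕ, ‖kraus b κ p.2 (x p.1)‖ₑ * ‖kraus b κ p.2 (y p.1)‖ₑ
        = ENNReal.ofReal (‖kraus b κ p.2 (x p.1)‖ * ‖kraus b κ p.2 (y p.1)‖) := fun p => by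
      rw [ENNReal.ofReal_mul (norm_nonneg _), ofReal_norm, ofReal_norm]
    have h2 : ∑' l, g l = ∑' p : ℕ × ℕ, ‖kraus b κ p.2 (x p.1)‖ₑ * ‖kraus b κ p.2 (y p.1)‖ₑ := by
      rw [ENNReal.tsum_prod', ENNReal.tsum_comm]
    rw [h2]
    simp only [h1]
    rw [← ENNReal.ofReal_tsum_of_nonneg (fun p => by positivity)
      (summable_norm_kraus_prod b hκ hs)]
    exact ENNReal.ofReal_ne_top
  refine tendsto_of_tendsto_of_tendsto_of_le_of_le tendsto_const_nhds
    (ENNReal.tendsto_tsum_compl_atTop_zero hfin) (fun _ => bot_le) fun s => ?_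
  refine (traceNorm_le (isDyadSum_krausSum_sub b hκ hd hs s e)).trans_eq ?_
  rw [e.tsum_eq (fun p : ℕ × ℕ => ‖(if p.2 ∈ s then 0 else kraus b κ p.2 (x p.1) : H)‖ₑ
    * ‖kraus b κ p.2 (y p.1)‖ₑ), ENNReal.tsum_prod', ENNReal.tsum_comm]
  refine Eq.trans ?_ (tsum_subtype {l | l ∉ s} g).symm
  refine tsum_congr fun l => ?_
  by_cases hl : l ∈ s
  · simp [hl]
  · simp [hl, hg]

end

end PhaseConj

end

theorem theorem2 {H : Type*} [NormedAddCommGroup H] [InnerProductSpace ℂ H] [CompleteSpace H]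
    (b : HilbertBasis ℕ ℂ H) (κ : ℝ) (hκ : 0 < κ) :
    ∃ Φ : PhaseConj.TraceClass H →ₗ[ℂ] PhaseConj.TraceClass H,
      (∀ ρ ρ' : PhaseConj.TraceClass H,
        PhaseConj.weylChar b ρ' = PhaseConj.phaseConj κ (PhaseConj.weylChar b ρ) ↔ ρ' = Φ ρ) ∧
      PhaseConj.IsCompletelyPositive Φ ∧
      (∀ ρ : PhaseConj.TraceClass H,
        Tendsto (fun s : Finset ℕ => PhaseConj.traceNorm
          (((Φ ρ : PhaseConj.TraceClass H) : H →L[ℂ] H) - ∑ l ∈ s, PhaseConj.kraus b κ l ∘L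
            (ρ : H →L[ℂ] H) ∘L ContinuousLinearMap.adjoint (PhaseConj.kraus b κ l)))
          atTop (𝓝 0)) := by
  refine ⟨PhaseConj.channel b hκ, fun ρ ρ' => ⟨fun h => ?_, fun h => ?_⟩,
    PhaseConj.isCompletelyPositive_channel b hκ,
    fun ρ => PhaseConj.tendsto_traceNorm_krausSum_sub b hκ ρ.2⟩
  · rw [← PhaseConj.weylChar_channel b hκ ρ] at h
    refine sub_eq_zero.1 (PhaseConj.eq_zero_of_weylChar_eq_zero b fun ξ => ?_)
    rw [PhaseConj.weylChar_sub, h, sub_self]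
  · rw [h, PhaseConj.weylChar_channel]
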